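/- There exists a Toeplitz subshift of topological rank $2$ which is not a strong Toeplitz subshift of rank $2$. In particular, it is not true that for every $K\ge 2$ every Toeplitz subshift of topological rank $K$ is a strong Toeplitz subshift of rank $K$. Here a subshift is a closed shift-invariant subset of $\mathsf A^{\mathbb Z}$, $\mathsf A$ a finite alphabet, with the shift $S(x)(i)=x(i+1)$, and conjugate means conjugate by a homeomorphism intertwining the maps. A subshift is Toeplitz if it is the orbit closure of some $x\in\mathsf A^{\mathbb Z}$ such that for every $i\in\mathbb Z$ there is $p\ge 1$ with $x(i+kp)=x(i)$ for all $k\in\mathbb Z$. A minimal Cantor system has topological rank $K$ if $K$ is the least finite value of $\liminf_n|V_n|$ over all simple properly ordered Bratteli diagrams $(V,E,\preceq)$, with vertex levels $V_0,V_1,\dots$, whose Bratteli--Vershik system is conjugate to it. A subshift is a strong Toeplitz subshift of rank $K$ if it is conjugate to the $\mathcal S$-adic subshift generated by some sequence $(\tau_n\colon A_{n+1}^*\to A_n^*)_{n\ge0}$ of non-erasing morphisms between finite alphabets with $\liminf_n|A_n|\le K$ that is - constant-length: for each $n$ all words $\tau_n(a)$, $a\in A_{n+1}$, have the same length; - primitive: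 for each $n$ there is $N>n$ such that every letter of $A_n$ occurs in $\tau_n\circ\cdots\circ\tau_{N-1}(a)$ for every $a\in A_N$; - proper: for each $n$ all words $\tau_n(a)$ begin with the same letter and end with the same letter; and - recognizable: for each $n$, every $x\in A_n^{\mathbb Z}$ has at most one representation $x=S^k\tau_n(y)$ with $y\in X^{(n+1)}$ and $0\le k<|\tau_n(y(0))|$, where $X^{(n)}\subseteq A_n^{\mathbb Z}$ is the set of points all of whose finite subwords occur in words $\tau_n\circ\cdots\circ\tau_{N-1}(a)$ with $N>n$, $a\in A_N$, and the $\mathcal S$-adic subshift generated by the sequence is $X^{(0)}$. -/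

import Mathlib

noncomputable section

namespace ToeplitzRank

open SymbolicDynamics.FullShift

/-! ### Topological dynamical systems -/

/-- Conjugacy of `(X, T)` and `(Y, S)`. -/
def Conjugate {X Y : Type*} [TopologicalSpace X] [TopologicalSpace Y]
    (T : X → X) (S : Y → Y) : Prop :=
  ∃ h : X ≃ₜ Y, Function.Semiconj h T S

/-- `(X, T)` is a minimal Cantor system: `X` is a Cantor space and every orbit of the homeomorphism
`T` is dense. -/
structure IsMinimalCantorSystem {X : Type*} [TopologicalSpace X] (T : X ≃ₜ X) : Prop where
  nonempty : Nonempty X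
  compact : CompactSpace X
  metrizable : TopologicalSpace.MetrizableSpace X
  zeroDimensional : TotallyDisconnectedSpace X
  perfect : PerfectSpace X
  minimal : ∀ x : X, Dense (Set.range fun k : ℤ => (T ^ k) x)

/-! ### Subshifts and Toeplitz subshifts -/

/-- The shift `S x i = x (i + 1)` restricted to a two-sided subshift. -/
def shiftHomeo {A : Type*} [TopologicalSpace A] (X : Subshift A ℤ) :
    X.carrier ≃ₜ X.carrier where
  toFun x := ⟨shift 1 x.1, X.mapsTo 1 x.2⟩
  invFun x := ⟨shift (-1) x.1, X.mapsTo (-1) x.2⟩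
  left_inv x := by
    apply Subtype.ext
    funext i
    simp [shift]
  right_inv x := by
    apply Subtype.ext
    funext i
    simp [shift]
  continuous_toFun := by fun_prop
  continuous_invFun := by fun_prop

/-- Toeplitz sequences. -/
def IsToeplitzSequence {A : Type*} (x : ℤ → A) : Prop :=
  ∀ i : ℤ, ∃ p : ℕ, 1 ≤ p ∧ ∀ k : ℤ, x (i + k * p) = x i

/-- A Toeplitz subshift is the closure of the orbit of a Toeplitz sequence. -/
def IsToeplitz {A : Type*} [TopologicalSpace A] (X : Subshift A ℤ) : Prop :=
  ∃ x : ℤ → A, IsToeplitzSequence x ∧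
    X.carrier = closure (Set.range fun k : ℤ => shift k x)

/-! ### Bratteli diagrams and the Vershik map -/

/-- Bratteli diagrams. The edges in `E n` go from level `n` to level `n + 1`. -/
structure BratteliDiagram where
  V : ℕ → Type
  E : ℕ → Type
  fintypeV : ∀ n, Fintype (V n)
  fintypeE : ∀ n, Fintype (E n)
  root : Unique (V 0)
  src : ∀ {n}, E n → V n
  tgt : ∀ {n}, E n → V (n + 1)
  src_surjective : ∀ n, Function.Surjective (src (n := n))
  tgt_surjective : ∀ n, Function.Surjective (tgt (n := n))

attribute [instance] BratteliDiagram.fintypeV BratteliDiagram.fintypeE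

namespace BratteliDiagram

/-- `B.Joined u v`: there is a finite path from `u` down to `v`. -/
inductive Joined (B : BratteliDiagram) {n : ℕ} (u : B.V n) : ∀ {m : ℕ}, B.V m → Prop
  | refl : Joined B u u
  | step {m : ℕ} (e : B.E m) : Joined B u (B.src e) → Joined B u (B.tgt e)

/-- Some telescoping has an edge between any two vertices of consecutive levels. -/
def IsSimple (B : BratteliDiagram) : Prop :=
  ∃ t : ℕ → ℕ, StrictMono t ∧ t 0 = 0 ∧
    ∀ (k : ℕ) (u : B.V (t k)) (v : B.V (t (k + 1))), B.Joined u v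

/-- The rank `liminf |V n|`, possibly infinite. -/
def rank (B : BratteliDiagram) : ℕ∞ :=
  Filter.liminf (fun n => (Fintype.card (B.V n) : ℕ∞)) Filter.atTop

/-- The space of infinite paths. -/
def PathSpace (B : BratteliDiagram) : Type :=
  {e : ∀ n, B.E n // ∀ n, B.tgt (e n) = B.src (e (n + 1))}

instance (B : BratteliDiagram) (n : ℕ) : TopologicalSpace (B.E n) := ⊥

instance (B : BratteliDiagram) : TopologicalSpace B.PathSpace :=
  inferInstanceAs (TopologicalSpace {e : ∀ n, B.E n // ∀ n, B.tgt (e n) = B.src (e (n + 1))})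

end BratteliDiagram

/-- Ordered Bratteli diagrams: edges are comparable exactly when they have the same range. -/
structure OrderedBratteliDiagram extends BratteliDiagram where
  partialOrderE : ∀ n, PartialOrder (E n)
  comparable_iff : ∀ {n} (e f : E n), (e ≤ f ∨ f ≤ e) ↔ tgt e = tgt f

attribute [instance] OrderedBratteliDiagram.partialOrderE

namespace OrderedBratteliDiagram

variable (B : OrderedBratteliDiagram)

/-- There is exactly one path of maximal edges and exactly one path of minimal edges. -/
def IsProperlyOrdered : Prop :=
  (∃! e : B.PathSpace, ∀ n, IsMax (e.1 n)) ∧ (∃! e : B.PathSpace, ∀ n, IsMin (e.1 n))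

/-- The graph of the Vershik map: `f` is the image of `e`. -/
def VershikStep (e f : B.PathSpace) : Prop :=
  ((∀ n, IsMax (e.1 n)) ∧ ∀ n, IsMin (f.1 n)) ∨
  ∃ k, (∀ i < k, IsMax (e.1 i)) ∧ ¬ IsMax (e.1 k) ∧
    e.1 k ⋖ f.1 k ∧ (∀ i < k, IsMin (f.1 i)) ∧ ∀ i, k < i → f.1 i = e.1 i

variable {B}

theorem covBy_unique {n : ℕ} {a b c : B.E n} (hb : a ⋖ b) (hc : a ⋖ c) : b = c := by
  have h1 := (B.comparable_iff a b).1 (Or.inl hb.le)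
  have h2 := (B.comparable_iff a c).1 (Or.inl hc.le)
  rcases (B.comparable_iff b c).2 (h1.symm.trans h2) with h | h
  · exact (hc.eq_or_eq hb.le h).resolve_left hb.lt.ne'
  · exact ((hb.eq_or_eq hc.le h).resolve_left hc.lt.ne').symm

theorem isMin_unique {n : ℕ} {a b : B.E n} (ha : IsMin a) (hb : IsMin b)
    (h : B.tgt a = B.tgt b) : a = b := by
  rcases (B.comparable_iff a b).2 h with h | h
  · exact hb.eq_of_le h
  · exact (ha.eq_of_le h).symm

theorem exists_isMin {n : ℕ} (v : B.V (n + 1)) : ∃ e : B.E n, B.tgt e = v ∧ IsMin e := by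
  obtain ⟨e, rfl⟩ := B.tgt_surjective n v
  obtain ⟨m, hm, hmin⟩ := Set.Finite.exists_minimal (s := {f : B.E n | B.tgt f = B.tgt e})
    (Set.toFinite _) ⟨e, rfl⟩
  refine ⟨m, hm, fun b hb => hmin ?_ hb⟩
  exact ((B.comparable_iff b m).1 (Or.inl hb)).trans hm

theorem nonempty_E (n : ℕ) : Nonempty (B.E n) := by
  induction n with
  | zero => exact ⟨(B.src_surjective 0 B.root.default).choose⟩
  | succ n ih => exact ⟨(B.src_surjective (n + 1) (B.tgt ih.some)).choose⟩

theorem exists_minPath (n : ℕ) (e : B.E n) :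
    ∃ g : ∀ i, B.E i, g n = e ∧ ∀ i < n, IsMin (g i) ∧ B.tgt (g i) = B.src (g (i + 1)) := by
  induction n with
  | zero =>
    exact ⟨Function.update (fun i => (nonempty_E i).some) 0 e, by simp, by simp⟩
  | succ n ih =>
    obtain ⟨e', h1, h2⟩ := exists_isMin (B.src e)
    obtain ⟨g, hg, hg'⟩ := ih e'
    refine ⟨Function.update g (n + 1) e, by simp, fun i hi => ?_⟩
    rw [Function.update_of_ne hi.ne]
    rcases Nat.lt_succ_iff_lt_or_eq.1 hi with h | rfl
    · rw [Function.update_of_ne (by omega)]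
      exact hg' i h
    · rw [Function.update_self, hg]
      exact ⟨h2, h1⟩

theorem existsUnique_vershikStep (hB : B.IsProperlyOrdered) (e : B.PathSpace) :
    ∃! f, B.VershikStep e f := by
  classical
  by_cases he : ∀ n, IsMax (e.1 n)
  · obtain ⟨f, hf, hu⟩ := hB.2
    refine ⟨f, Or.inl ⟨he, hf⟩, ?_⟩
    rintro f' (⟨-, h⟩ | ⟨k, -, h, -⟩)
    · exact hu f' h
    · exact absurd (he k) h
  · push Not at he
    have hk := Nat.find_spec he
    have hlt : ∀ i < Nat.find he, IsMax (e.1 i) := fun i hi => not_not.1 (Nat.find_min he hi)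
    set k := Nat.find he with hkdef
    obtain ⟨s, hs⟩ := exists_covBy_of_wellFoundedLT hk
    have hst := (B.comparable_iff (e.1 k) s).1 (Or.inl hs.le)
    obtain ⟨g, hg, hg'⟩ := exists_minPath k s
    refine ⟨⟨fun i => if i ≤ k then g i else e.1 i, fun i => ?_⟩,
      Or.inr ⟨k, hlt, hk, ?_, fun i hi => ?_, fun i hi => ?_⟩, ?_⟩
    · rcases lt_trichotomy i k with h | h | h
      · simp only [h.le, Nat.succ_le_of_lt h, if_true]
        exact (hg' i h).2
      · subst h
        simp only [le_refl, if_true, Nat.not_succ_le_self, if_false, hg]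
        rw [← e.2, hst]
      · simp only [not_le.2 h, not_le.2 (h.trans (Nat.lt_succ_self i)), if_false]
        exact e.2 i
    · simpa [hg] using hs
    · simpa [hi.le] using (hg' i hi).1
    · simp [not_le.2 hi]
    · rintro f (⟨h, -⟩ | ⟨k', h1, h2, h3, h4, h5⟩)
      · exact absurd (h k) hk
      · have hkk : k' = k := by
          rcases lt_trichotomy k' k with h | h | h
          · exact absurd (hlt k' h) h2
          · exact h
          · exact absurd (h1 k h) hk
        subst hkk
        have key : ∀ j ≤ k, f.1 (k - j) = g (k - j) := by
          intro j
          induction j with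
          | zero => exact fun _ => (covBy_unique h3 hs).trans hg.symm
          | succ j ih =>
            intro hj
            have h6 := ih (by omega)
            have hlt' : k - (j + 1) < k := by omega
            have heq : k - j = k - (j + 1) + 1 := by omega
            rw [heq] at h6
            refine isMin_unique (h4 _ hlt') (hg' _ hlt').1 ?_
            rw [f.2, (hg' _ hlt').2, h6]
        apply Subtype.ext
        funext i
        by_cases hi : i ≤ k
        · have := key (k - i) (by omega)
          rw [Nat.sub_sub_self hi] at this
          simpa [hi] using this
        · simpa [hi] using h5 i (not_le.1 hi)

/-- The Vershik map of a properly ordered Bratteli diagram. -/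
def vershikMap (hB : B.IsProperlyOrdered) (e : B.PathSpace) : B.PathSpace :=
  (existsUnique_vershikStep hB e).choose

theorem vershikMap_spec (hB : B.IsProperlyOrdered) (e : B.PathSpace) :
    B.VershikStep e (vershikMap hB e) :=
  (existsUnique_vershikStep hB e).choose_spec.1

end OrderedBratteliDiagram

/-- `(X, T)` is a minimal Cantor system of topological rank `K`: the least finite rank of a
Bratteli-Vershik representation is `K`. -/
def HasTopologicalRank {X : Type*} [TopologicalSpace X] (T : X ≃ₜ X) (K : ℕ) : Prop :=
  IsMinimalCantorSystem T ∧
  IsLeast {k : ℕ | ∃ (B : OrderedBratteliDiagram) (hB : B.IsProperlyOrdered),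
    B.IsSimple ∧ B.rank = k ∧ Conjugate T (OrderedBratteliDiagram.vershikMap hB)} K

/-! ### Morphisms and `S`-adic subshifts -/

/-- A non-erasing morphism `A* → B*`, given by the images of the letters. -/
structure Morphism (A B : Type) where
  word : A → List B
  nonerasing : ∀ a, word a ≠ []

namespace Morphism

variable {A B : Type} (τ : Morphism A B)

/-- The position in `τ(y) = ⋯ τ(y(-1)).τ(y(0))τ(y(1)) ⋯` at which `τ(y(n))` begins. -/
def cut (y : ℤ → A) : ℤ → ℤ
  | Int.ofNat n => ∑ i ∈ Finset.range n, ((τ.word (y i)).length : ℤ)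
  | Int.negSucc n => -∑ i ∈ Finset.range (n + 1), ((τ.word (y (-(i + 1)))).length : ℤ)

theorem cut_succ (y : ℤ → A) (n : ℤ) :
    τ.cut y (n + 1) = τ.cut y n + (τ.word (y n)).length := by
  match n with
  | Int.ofNat n =>
    change τ.cut y (Int.ofNat (n + 1)) = _
    simp [cut, Finset.sum_range_succ]
  | Int.negSucc 0 =>
    change τ.cut y (Int.ofNat 0) = _
    simp [cut]
  | Int.negSucc (n + 1) =>
    change τ.cut y (Int.negSucc n) = _
    have h : (Int.negSucc (n + 1)) = -(((n + 1 : ℕ) : ℤ) + 1) := by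
      rw [Int.negSucc_eq]
    simp only [cut]
    rw [Finset.sum_range_succ _ (n + 1), h]
    ring

theorem one_le_length (a : A) : (1 : ℤ) ≤ (τ.word a).length := by
  exact_mod_cast List.length_pos_iff.2 (τ.nonerasing a)

theorem cut_strictMono (y : ℤ → A) : StrictMono (τ.cut y) :=
  strictMono_int_of_lt_succ fun n => by
    have := τ.one_le_length (y n)
    rw [cut_succ]
    omega

theorem exists_cut (y : ℤ → A) (j : ℤ) :
    ∃ n : ℤ, ∃ i : ℕ, i < (τ.word (y n)).length ∧ τ.cut y n + i = j := by
  have hm : Monotone fun n => τ.cut y n - n := monotone_int_of_le_succ fun n => by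
    have := τ.one_le_length (y n)
    rw [cut_succ]
    omega
  have h0 : τ.cut y 0 = 0 := by
    change τ.cut y (Int.ofNat 0) = 0
    simp [cut]
  obtain ⟨n, hn, hmax⟩ := Int.exists_greatest_of_bdd (P := fun n => τ.cut y n ≤ j)
    ⟨max j 0, fun z hz => by
      by_contra! hc
      have h1 := hm (show 0 ≤ z by omega)
      simp only [h0] at h1
      omega⟩
    ⟨min j 0, by
      have h1 := hm (min_le_right j 0)
      simp only [h0] at h1
      omega⟩
  have h2 : j < τ.cut y (n + 1) := by
    by_contra! hc
    have := hmax (n + 1) hc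
    omega
  rw [cut_succ] at h2
  exact ⟨n, (j - τ.cut y n).toNat, by omega, by omega⟩

theorem cut_inj (y : ℤ → A) {n m : ℤ} {i j : ℕ} (hi : i < (τ.word (y n)).length)
    (hj : j < (τ.word (y m)).length) (h : τ.cut y n + i = τ.cut y m + j) : n = m := by
  have h1 := τ.cut_succ y n
  have h2 := τ.cut_succ y m
  rcases lt_trichotomy n m with hlt | heq | hlt
  · have := (τ.cut_strictMono y).monotone (Int.add_one_le_iff.2 hlt)
    omega
  · exact heq
  · have := (τ.cut_strictMono y).monotone (Int.add_one_le_iff.2 hlt)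
    omega

theorem existsUnique_image (y : ℤ → A) :
    ∃! z : ℤ → B, ∀ (n : ℤ) (i : ℕ) (h : i < (τ.word (y n)).length),
      z (τ.cut y n + i) = (τ.word (y n))[i] := by
  choose N I hI hN using τ.exists_cut y
  refine ⟨fun j => (τ.word (y (N j)))[I j]'(hI j), fun n i h => ?_, fun z hz => ?_⟩
  · have h1 := hN (τ.cut y n + i)
    have h2 := τ.cut_inj y (hI _) h h1
    have h3 : I (τ.cut y n + i) = i := by
      rw [h2] at h1
      omega
    simp only [h2, h3]
  · funext j
    rw [← hz (N j) (I j) (hI j), hN]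

/-- The bi-infinite word `τ(y) = ⋯ τ(y(-1)).τ(y(0))τ(y(1)) ⋯`. -/
def image (y : ℤ → A) : ℤ → B :=
  (τ.existsUnique_image y).choose

theorem image_spec (y : ℤ → A) (n : ℤ) (i : ℕ) (h : i < (τ.word (y n)).length) :
    τ.image y (τ.cut y n + i) = (τ.word (y n))[i] :=
  (τ.existsUnique_image y).choose_spec.1 n i h

/-- `(y, k)` is a centered `τ`-representation of `x`. -/
def IsCenteredRepresentation (y : ℤ → A) (k : ℤ) (x : ℤ → B) : Prop :=
  x = shift k (τ.image y) ∧ 0 ≤ k ∧ k < (τ.word (y 0)).length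

/-- Every `x` has at most one centered `τ`-representation in `Y`. -/
def IsRecognizableIn (Y : Set (ℤ → A)) : Prop :=
  ∀ (x : ℤ → B) (y y' : ℤ → A) (k k' : ℤ), y ∈ Y → y' ∈ Y →
    τ.IsCenteredRepresentation y k x → τ.IsCenteredRepresentation y' k' x → y = y' ∧ k = k'

/-- All images of letters start with the same letter and end with the same letter. -/
def IsProper : Prop :=
  ∃ p q : B, ∀ a, (τ.word a).head? = some p ∧ (τ.word a).getLast? = some q

def HasConstantLength : Prop :=
  ∃ l : ℕ, ∀ a, (τ.word a).length = l

end Morphism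

/-- Directive sequences of non-erasing morphisms `τ n : A (n + 1)* → A n*` between finite
alphabets. -/
structure DirectiveSequence where
  A : ℕ → Type
  fintypeA : ∀ n, Fintype (A n)
  nonemptyA : ∀ n, Nonempty (A n)
  τ : ∀ n, Morphism (A (n + 1)) (A n)

attribute [instance] DirectiveSequence.fintypeA

/-- The word `x[i, i + l)`. -/
def subword {A : Type*} (x : ℤ → A) (i : ℤ) (l : ℕ) : List A :=
  List.ofFn fun k : Fin l => x (i + k)

namespace DirectiveSequence

variable (D : DirectiveSequence)

instance (n : ℕ) : TopologicalSpace (D.A n) := ⊥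

instance (n : ℕ) : DiscreteTopology (D.A n) := ⟨rfl⟩

/-- `D.comp n k a` is the word `τ_{[n, n + k)}(a)`. -/
def comp (n : ℕ) : ∀ k : ℕ, D.A (n + k) → List (D.A n)
  | 0, a => [a]
  | k + 1, a => ((D.τ (n + k)).word a).flatMap (comp n k)

/-- The language `L⁽ⁿ⁾`: words occurring in `τ_{[n, N)}(a)` for some `N > n` and some letter `a`. -/
def language (n : ℕ) : Set (List (D.A n)) :=
  {w | ∃ k : ℕ, 1 ≤ k ∧ ∃ a : D.A (n + k), w <:+: D.comp n k a}

/-- The points of `X⁽ⁿ⁾`: all finite subwords are subwords of words in `L⁽ⁿ⁾`. -/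
def points (n : ℕ) : Set (ℤ → D.A n) :=
  {x | ∀ (i : ℤ) (l : ℕ), ∃ w ∈ D.language n, subword x i l <:+: w}

/-- The subshift `X⁽ⁿ⁾`; the `S`-adic subshift generated by the directive sequence is `X⁽⁰⁾`. -/
def levelSubshift (n : ℕ) : Subshift (D.A n) ℤ where
  carrier := D.points n
  isClosed := by
    have h : D.points n = ⋂ (i : ℤ) (l : ℕ),
        (fun (x : ℤ → D.A n) (k : Fin l) => x (i + k)) ⁻¹'
          {u | ∃ w ∈ D.language n, List.ofFn u <:+: w} := by
      ext x
      simp [points, subword]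
    rw [h]
    exact isClosed_iInter fun i => isClosed_iInter fun l =>
      (isClosed_discrete _).preimage (by fun_prop)
  mapsTo := by
    intro g x hx i l
    obtain ⟨w, hw, h⟩ := hx (g + i) l
    refine ⟨w, hw, ?_⟩
    simpa [subword, shift, add_assoc] using h

/-- The alphabet rank `liminf |A n|`, possibly infinite. -/
def alphabetRank : ℕ∞ :=
  Filter.liminf (fun n => (Fintype.card (D.A n) : ℕ∞)) Filter.atTop

def IsPrimitive : Prop :=
  ∀ n, ∃ k : ℕ, 1 ≤ k ∧ ∀ (a : D.A (n + k)) (b : D.A n), b ∈ D.comp n k a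

def IsProper : Prop := ∀ n, (D.τ n).IsProper

def HasConstantLength : Prop := ∀ n, (D.τ n).HasConstantLength

def IsRecognizable : Prop := ∀ n, (D.τ n).IsRecognizableIn (D.points (n + 1))

end DirectiveSequence

/-- Strong Toeplitz subshifts of rank `K`. -/
def IsStrongToeplitz {A : Type*} [TopologicalSpace A] (X : Subshift A ℤ) (K : ℕ) : Prop :=
  ∃ D : DirectiveSequence, D.HasConstantLength ∧ D.IsPrimitive ∧ D.IsProper ∧ D.IsRecognizable ∧
    D.alphabetRank ≤ K ∧ Conjugate (shiftHomeo X) (shiftHomeo (D.levelSubshift 0))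

end ToeplitzRank

end

noncomputable section

namespace ToeplitzRank

open SymbolicDynamics.FullShift Filter Topology

/-! ### Limits along ultrafilters in finite types -/

/-! The obstruction to strong rank `K` is a family of `K + 1` distinct, jointly proximal points.
Take such a family in an `S`-adic subshift of constant length and desubstitute all its points.
Passing to a limit along a proximality ultrafilter, recognizability forces equal cutting phases and
joint proximality of the preimages (`proximal_of_isCenteredRepresentation`), so this repeats through
all levels. Infinitely many levels have at most `K` letters, so by pigeonhole some fixed pair has
the same letter at the origin at infinitely many levels. Constant length and equal phases carry this
agreement down to every level, and properness widens the window of agreement by one place on each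
side per level. The two points therefore coincide (`exists_eq_of_proximal`).

Topological rank does not require constant length. In the substitution of length seven below, `1`
and `2` occur only as the block `12`, so each level is built from two units, `0` and `12`, whose
images consist of 6 and 10 units. This gives a simple properly ordered diagram with two vertices per
level (`conjugate_unitDiagram`). On the three letters, however, column 3 is the identity and column
0 is constant. The three points fixed by substituting and shifting by 3 are thus distinct at the
origin and proximal under the inverse shift (`exists_tendsto_proximalPt`), which excludes strong
rank 2.

Rank at most one is excluded by the same points: where a level has a single vertex, the initial
segment of a path determines that of its Vershik image, so points whose backward orbits converge to
a common limit along one ultrafilter are equal (`eq_of_rank_le_one`). -/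

theorem exists_eventually_eq {ι α : Type*} [Finite α] (F : Ultrafilter ι) (f : ι → α) :
    ∃ a, ∀ᶠ i in F, f i = a := by
  obtain ⟨a, ha⟩ := (F.map f).eq_pure_of_finite
  refine ⟨a, ?_⟩
  have : {a} ∈ F.map f := by rw [ha]; exact Set.mem_singleton a
  exact this

theorem exists_eventually_eq_int {ι : Type*} (F : Ultrafilter ι) {l : ℕ} (f : ι → ℤ)
    (hf : ∀ i, 0 ≤ f i ∧ f i < l) : ∃ a : ℤ, (0 ≤ a ∧ a < l) ∧ ∀ᶠ i in F, f i = a := by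
  obtain ⟨a, ha⟩ := exists_eventually_eq F
    fun i => (⟨(f i).toNat, by have := hf i; omega⟩ : Fin l)
  refine ⟨a, by omega, ha.mono fun i hi => ?_⟩
  have := congrArg Fin.val hi
  have := hf i
  simp only at *
  omega

theorem emod_eq_emod_imp_eq {l k d d' : ℤ} (hd : 0 ≤ d ∧ d < l) (hd' : 0 ≤ d' ∧ d' < l)
    (h : (k + d) % l = (k + d') % l) : d = d' := by
  have h1 : d % l = d' % l := (Int.ModEq.add_left_cancel' k h : d ≡ d' [ZMOD l])
  rwa [Int.emod_eq_of_lt hd.1 hd.2, Int.emod_eq_of_lt hd'.1 hd'.2] at h1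

theorem frequently_le_of_liminf_le {c : ℕ → ℕ} {K : ℕ}
    (h : liminf (fun n => (c n : ℕ∞)) atTop ≤ K) : ∃ᶠ n in atTop, c n ≤ K := by
  have h1 : liminf (fun n => (c n : ℕ∞)) atTop < ((K + 1 : ℕ) : ℕ∞) :=
    h.trans_lt (by exact_mod_cast Nat.lt_succ_self K)
  refine (frequently_lt_of_liminf_lt (by isBoundedDefault) h1).mono fun n hn => ?_
  exact Nat.lt_succ_iff.1 (by exact_mod_cast hn)

/-- `u s` and `u t` agree on arbitrarily large windows, for all `s` and `t` simultaneously. -/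
def Proximal {ι A : Type*} (u : ι → ℤ → A) : Prop :=
  ∃ F : Ultrafilter ℤ, ∀ s t i, ∀ᶠ k in F, u s (k + i) = u t (k + i)

/-! ### Morphisms of constant length -/

namespace Morphism

variable {A B : Type} (τ : Morphism A B) {l : ℕ}

theorem cut_of_length (hl : ∀ a, (τ.word a).length = l) (y : ℤ → A) (n : ℤ) :
    τ.cut y n = n * l := by
  have h0 : τ.cut y 0 = 0 := by
    change τ.cut y (Int.ofNat 0) = 0
    simp [cut]
  induction n using Int.induction_on with
  | zero => simpa using h0
  | succ n ih => rw [cut_succ, ih, hl]; ring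
  | pred n ih =>
    have := τ.cut_succ y (-(n : ℤ) - 1)
    rw [sub_add_cancel, ih, hl] at this
    linarith

theorem length_pos [Nonempty A] (hl : ∀ a, (τ.word a).length = l) : 0 < l := by
  rw [← hl (Classical.arbitrary A)]
  exact List.length_pos_iff.2 (τ.nonerasing _)

theorem getElem?_word [Nonempty A] (hl : ∀ a, (τ.word a).length = l) (y : ℤ → A) (m : ℤ) :
    (τ.word (y (m / l)))[(m % l).toNat]? = some (τ.image y m) := by
  have hl0 : (0 : ℤ) < l := by exact_mod_cast τ.length_pos hl
  have h1 := Int.emod_nonneg m hl0.ne'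
  have h2 := Int.emod_lt_of_pos m hl0
  have hlt : (m % l).toNat < (τ.word (y (m / l))).length := by rw [hl]; omega
  have h := τ.image_spec y (m / l) _ hlt
  rw [τ.cut_of_length hl, Int.toNat_of_nonneg h1, Int.ediv_mul_add_emod] at h
  rw [h, List.getElem?_eq_getElem]

theorem image_congr [Nonempty A] (hl : ∀ a, (τ.word a).length = l) {y y' : ℤ → A} {m m' : ℤ}
    (h : y (m / l) = y' (m' / l)) (h' : m % l = m' % l) : τ.image y m = τ.image y' m' := by
  have h1 := τ.getElem?_word hl y m
  rw [h, h', τ.getElem?_word hl y' m'] at h1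
  exact (Option.some_injective _ h1).symm

theorem image_congr_of_isProper [Nonempty A] (hl : ∀ a, (τ.word a).length = l)
    (hτ : τ.IsProper) (y y' : ℤ → A) {m : ℤ}
    (h : m % l = 0 ∨ m % l = l - 1) : τ.image y m = τ.image y' m := by
  have hl0 : 0 < l := τ.length_pos hl
  obtain ⟨p, q, hpq⟩ := hτ
  have h1 := τ.getElem?_word hl y m
  have h2 := τ.getElem?_word hl y' m
  apply Option.some_injective
  rw [← h1, ← h2]
  rcases h with h | h
  · simp only [h, Int.toNat_zero, ← List.head?_eq_getElem?, (hpq _).1]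
  · have : (m % l).toNat = l - 1 := by omega
    rw [this]
    have h3 := (hpq (y (m / l))).2
    have h4 := (hpq (y' (m / l))).2
    rw [List.getLast?_eq_getElem?, hl] at h3 h4
    rw [h3, h4]

end Morphism

/-! ### Desubstitution and joint proximality in `S`-adic subshifts -/

theorem getElem?_flatMap_of_length {A B : Type*} {f : A → List B} {l : ℕ}
    (hl : ∀ a, (f a).length = l) (v : List A) (q r : ℕ) (hr : r < l) :
    (v.flatMap f)[q * l + r]? = v[q]?.bind fun a => (f a)[r]? := by
  induction v generalizing q with
  | nil => simp
  | cons a v ih =>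
    rw [List.flatMap_cons]
    cases q with
    | zero => rw [List.getElem?_append_left (by rw [hl]; omega)]; simp
    | succ q =>
      rw [List.getElem?_append_right (by rw [hl]; nlinarith), hl,
        show (q + 1) * l + r - l = q * l + r by rw [Nat.succ_mul]; omega, ih]
      simp

namespace DirectiveSequence

variable (D : DirectiveSequence)

instance (n : ℕ) : Nonempty (D.A n) := D.nonemptyA n

theorem word_cast {m m' : ℕ} (h : m = m') (a : D.A (m + 1)) :
    (D.τ m').word (cast (by rw [h]) a) =
      ((D.τ m).word a).map (cast (by rw [h] : D.A m = D.A m')) := by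
  subst h
  simp only [cast_eq]
  exact (List.map_id _).symm

/-- The recursion defining `comp` splits off the highest morphism; desubstitution at level `n` needs
the lowest one, `τ n`, split off instead. -/
theorem comp_succ_eq (n k : ℕ) (a : D.A (n + (k + 1))) :
    D.comp n (k + 1) a =
      (D.comp (n + 1) k (cast (by rw [Nat.add_right_comm n 1 k, Nat.add_assoc]) a)).flatMap
        (D.τ n).word := by
  induction k with
  | zero =>
    simp only [comp, List.flatMap_cons, List.flatMap_nil, List.append_nil]
    exact (List.flatMap_singleton' _)
  | succ k ih =>
    rw [comp]
    have h : n + (k + 1) = n + 1 + k := by omega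
    have h2 := D.word_cast h a
    conv_rhs => rw [comp]
    rw [h2, List.flatMap_map, List.flatMap_assoc]
    congr 1
    funext b
    exact ih b

/-- The language only admits `k ≥ 1`. For `k = 0` the word is a single letter, and primitivity
places it inside a longer word. -/
theorem comp_mem_language (hD : D.IsPrimitive) (n k : ℕ) (a : D.A (n + k)) :
    ∃ w ∈ D.language n, D.comp n k a <:+: w := by
  cases k with
  | zero =>
    obtain ⟨k, hk, h⟩ := hD n
    let b : D.A (n + k) := Classical.arbitrary _
    exact ⟨_, ⟨k, hk, b, List.infix_rfl⟩, by
      rw [comp]; exact List.singleton_infix_iff _ _ |>.2 (h b a)⟩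
  | succ k => exact ⟨_, ⟨k + 1, by omega, a, List.infix_rfl⟩, List.infix_rfl⟩

variable {D}

/-- Desubstitution on a finite window: the window lies in a concatenation of blocks of length `l`,
so the position of the origin modulo `l` gives the phase and its block becomes index 0. The last
clause controls only subwords whose blocks start inside the window. -/
theorem exists_window {n l : ℕ} (hD : D.IsPrimitive) (hl : ∀ a, ((D.τ n).word a).length = l)
    {x : ℤ → D.A n} (hx : x ∈ D.points n) (N : ℕ) :
    ∃ (y : ℤ → D.A (n + 1)) (d : ℤ), (0 ≤ d ∧ d < l) ∧
      (∀ m : ℤ, -N ≤ m → m ≤ N →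
        ((D.τ n).word (y ((m + d) / l)))[((m + d) % l).toNat]? = some (x m)) ∧
      ∀ (i : ℤ) (len : ℕ), (∀ j, i ≤ j → j < i + len → -N ≤ j * l - d ∧ j * l - d ≤ N) →
        ∃ w ∈ D.language (n + 1), subword y i len <:+: w := by
  have hl0 : 0 < l := (D.τ n).length_pos hl
  have hl0' : (0 : ℤ) < l := by exact_mod_cast hl0
  obtain ⟨w, ⟨k, hk, a, hw⟩, hsub⟩ := hx (-N) (2 * N + 1)
  obtain ⟨k, rfl⟩ : ∃ k', k = k' + 1 := ⟨k - 1, by omega⟩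
  have hinf := hsub.trans hw
  rw [comp_succ_eq] at hinf
  obtain ⟨v', hv', hvv'⟩ := D.comp_mem_language hD (n + 1) k
    (cast (by rw [Nat.add_right_comm n 1 k, Nat.add_assoc]) a)
  set v := D.comp (n + 1) k (cast (by rw [Nat.add_right_comm n 1 k, Nat.add_assoc]) a)
  rw [List.infix_iff_getElem?] at hinf
  obtain ⟨o, -, ho⟩ := hinf
  simp only [subword, List.length_ofFn, List.getElem_ofFn] at ho
  set P : ℕ := o + N with hP
  have key : ∀ m : ℤ, -N ≤ m → m ≤ N → ∃ b, v[((P + m) / l).toNat]? = some b ∧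
      ((D.τ n).word b)[((P + m) % l).toNat]? = some (x m) := by
    intro m h1 h2
    have h3 := ho (m + N).toNat (by omega)
    have h4 : (-(N : ℤ) + ((m + N).toNat : ℕ)) = m := by omega
    rw [h4] at h3
    have h5 : (m + N).toNat + o = ((P + m) / l).toNat * l + ((P + m) % l).toNat := by
      have e1 : 0 ≤ (P + m) / (l : ℤ) := Int.ediv_nonneg (by omega) hl0'.le
      have e2 := Int.emod_nonneg (P + m) hl0'.ne'
      zify
      rw [Int.toNat_of_nonneg e1, Int.toNat_of_nonneg e2, Int.ediv_mul_add_emod]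
      omega
    rw [h5, getElem?_flatMap_of_length hl _ _ _ (by
      have e2 := Int.emod_lt_of_pos (P + m) hl0'
      have e3 := Int.emod_nonneg (P + m) hl0'.ne'
      omega)] at h3
    simpa [Option.bind_eq_some_iff] using h3
  have hdiv : ∀ m : ℤ, (P + m) / (l : ℤ) = P / l + (m + P % l) / l := by
    intro m
    conv_lhs => rw [← Int.mul_ediv_add_emod P l]
    rw [show (l : ℤ) * (P / l) + P % l + m = (m + P % l) + l * (P / l) by ring,
      Int.add_mul_ediv_left _ _ hl0'.ne']
    ring
  have hmod : ∀ m : ℤ, (P + m) % (l : ℤ) = (m + P % l) % l := by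
    intro m
    rw [Int.add_emod_emod, add_comm]
  -- Indices outside `v` get an arbitrary letter; they never meet the window.
  refine ⟨fun j => (v[(P / l + j : ℤ).toNat]?).getD (Classical.arbitrary _), (P : ℤ) % l,
    ⟨Int.emod_nonneg _ hl0'.ne', Int.emod_lt_of_pos _ hl0'⟩, fun m h1 h2 => ?_, fun i len h => ?_⟩
  · obtain ⟨b, hb, hb'⟩ := key m h1 h2
    beta_reduce
    rw [← hdiv, hb, ← hmod]
    exact hb'
  · refine ⟨v', hv', List.IsInfix.trans ?_ hvv'⟩
    have hj : ∀ j : ℤ, i ≤ j → j < i + len → 0 ≤ P / (l : ℤ) + j ∧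
        ∃ b, v[(P / l + j : ℤ).toNat]? = some b := by
      intro j h1 h2
      obtain ⟨h3, h4⟩ := h j h1 h2
      obtain ⟨b, hb, -⟩ := key _ h3 h4
      have e1 : 0 ≤ (P + (j * l - P % l)) / (l : ℤ) := Int.ediv_nonneg (by omega) hl0'.le
      rw [hdiv, sub_add_cancel, Int.mul_ediv_cancel _ hl0'.ne'] at hb e1
      exact ⟨e1, b, hb⟩
    rcases Nat.eq_zero_or_pos len with rfl | hlen
    · simp [subword]
    rw [List.infix_iff_getElem?]
    have h0 := (hj i le_rfl (by omega)).1
    have hget : ∀ t < len, ∃ b, v[t + (P / l + i : ℤ).toNat]? = some b := by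
      intro t ht
      obtain ⟨b, hb⟩ := (hj (i + t) (by omega) (by omega)).2
      refine ⟨b, ?_⟩
      rw [← hb]
      congr 1
      omega
    refine ⟨(P / l + i : ℤ).toNat, ?_, fun t ht => ?_⟩
    · obtain ⟨b, hb⟩ := hget (len - 1) (by omega)
      have := (List.getElem?_eq_some_iff.1 hb).1
      simp only [subword, List.length_ofFn]
      omega
    · simp only [subword, List.length_ofFn] at ht
      obtain ⟨b, hb⟩ := hget t ht
      simp only [subword, List.getElem_ofFn]
      rw [show (P / (l : ℤ) + (i + (t : ℤ))).toNat = t + (P / l + i : ℤ).toNat by omega, hb]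
      rfl

/-- Every point of `X⁽ⁿ⁾` can be desubstituted. -/
theorem exists_isCenteredRepresentation {n l : ℕ} (hD : D.IsPrimitive)
    (hl : ∀ a, ((D.τ n).word a).length = l) {x : ℤ → D.A n} (hx : x ∈ D.points n) :
    ∃ y ∈ D.points (n + 1), ∃ d, (D.τ n).IsCenteredRepresentation y d x := by
  choose Y d hd hY hL using exists_window hD hl hx
  -- Compactness: the phases and letters found on windows of radius `N` take finitely many values
  -- and have limits along `U`.
  let U : Ultrafilter ℕ := hyperfilter ℕ
  have hU : ∀ m : ℕ, ∀ᶠ N in U, m ≤ N := fun m =>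
    (Nat.hyperfilter_le_atTop (eventually_ge_atTop m) :)
  obtain ⟨e, he, hed⟩ := exists_eventually_eq_int U d hd
  choose y hy using fun i : ℤ => exists_eventually_eq U fun N => Y N i
  refine ⟨y, fun i len => ?_, e, ?_, he.1, by rw [hl]; exact he.2⟩
  · have h1 : ∀ᶠ N in U, ∀ j ∈ Set.Ico i (i + len), Y N j = y j :=
      (eventually_all_finite (Set.finite_Ico _ _)).2 fun j _ => hy j
    have h2 : ∀ᶠ N in U, ∀ j ∈ Set.Ico i (i + len), (j * l - e).natAbs ≤ N :=
      (eventually_all_finite (Set.finite_Ico _ _)).2 fun j _ => hU _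
    obtain ⟨N, h1, h2, h3⟩ := (h1.and (h2.and hed)).exists
    obtain ⟨w, hw, hw'⟩ := hL N i len (fun j hj hj' => by
      have := h2 j ⟨hj, hj'⟩
      rw [h3]
      omega)
    refine ⟨w, hw, ?_⟩
    have : subword y i len = subword (Y N) i len := by
      simp only [subword]
      congr 1
      funext k
      exact (h1 _ ⟨by omega, by omega⟩).symm
    rwa [this]
  · funext m
    obtain ⟨N, h1, h2, h3⟩ := ((hy ((m + e) / l)).and ((hU m.natAbs).and hed)).exists
    have h4 := hY N m (by omega) (by omega)
    rw [h3, h1, (D.τ n).getElem?_word hl] at h4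
    rw [shift_apply, add_comm e m]
    exact (Option.some_injective _ h4).symm

/-- Recognizability lifts proximality to the next level. -/
theorem proximal_of_isCenteredRepresentation {n l : ℕ}
    (hl : ∀ a, ((D.τ n).word a).length = l)
    (hR : (D.τ n).IsRecognizableIn (D.points (n + 1))) {ι : Type*} [Inhabited ι]
    {u : ι → ℤ → D.A n}
    (hu : Proximal u) {y : ι → ℤ → D.A (n + 1)} (hy : ∀ s, y s ∈ D.points (n + 1)) {d : ι → ℤ}
    (hrep : ∀ s, (D.τ n).IsCenteredRepresentation (y s) (d s) (u s)) :
    (∀ s t, d s = d t) ∧ Proximal y := by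
  obtain ⟨F, hF⟩ := hu
  have hl0 : (0 : ℤ) < l := by exact_mod_cast (D.τ n).length_pos hl
  -- The translates of `u s` by `k` tend along `F` to one point independent of `s`. Their
  -- desubstitutions tend to `Y s` with phase `e s`, so each pair represents that same point and
  -- recognizability applies.
  choose e he hed using fun s => exists_eventually_eq_int F (fun k => (k + d s) % (l : ℤ))
    fun k => ⟨Int.emod_nonneg _ hl0.ne', Int.emod_lt_of_pos _ hl0⟩
  choose Y hY using fun (s : ι) (i : ℤ) =>
    exists_eventually_eq F fun k => y s ((k + d s) / l + i)
  have hYmem : ∀ s, Y s ∈ D.points (n + 1) := by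
    intro s i len
    have h1 : ∀ᶠ k in F, ∀ j ∈ Set.Ico i (i + len), y s ((k + d s) / l + j) = Y s j :=
      (eventually_all_finite (Set.finite_Ico _ _)).2 fun j _ => hY s j
    obtain ⟨k, hk⟩ := h1.exists
    obtain ⟨w, hw, hw'⟩ := hy s ((k + d s) / l + i) len
    refine ⟨w, hw, ?_⟩
    have : subword (Y s) i len = subword (y s) ((k + d s) / l + i) len := by
      simp only [subword]
      congr 1
      funext j
      rw [add_assoc]
      exact (hk _ ⟨by omega, by omega⟩).symm
    rwa [this]
  have hlim : ∀ s i, ∀ᶠ k in F, u s (k + i) = (D.τ n).image (Y s) (e s + i) := by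
    intro s i
    filter_upwards [hed s, hY s ((e s + i) / l)] with k h1 h2
    rw [(hrep s).1, shift_apply]
    have h3 : d s + (k + i) = (e s + i) + l * ((k + d s) / l) := by
      have := Int.mul_ediv_add_emod (k + d s) l
      rw [h1] at this
      linarith
    apply (D.τ n).image_congr hl
    · rw [h3, Int.add_mul_ediv_left _ _ hl0.ne', ← h2]
      congr 1
      ring
    · rw [h3, Int.add_mul_emod_self_left]
  have heq : ∀ s t, Y s = Y t ∧ e s = e t := by
    intro s t
    refine hR (shift (e s) ((D.τ n).image (Y s))) (Y s) (Y t) (e s) (e t) (hYmem s) (hYmem t)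
      ⟨rfl, (he s).1, by rw [hl]; exact (he s).2⟩ ⟨?_, (he t).1, by rw [hl]; exact (he t).2⟩
    funext i
    obtain ⟨k, h1, h2, h3⟩ := ((hlim s i).and ((hlim t i).and (hF s t i))).exists
    rw [shift_apply, shift_apply, ← h1, ← h2, h3]
  have hd : ∀ s t, d s = d t := by
    intro s t
    obtain ⟨k, h1, h2⟩ := ((hed s).and (hed t)).exists
    have hs := (hrep s).2
    have ht := (hrep t).2
    rw [hl] at hs ht
    exact emod_eq_emod_imp_eq hs ht (h1.trans ((heq s t).2.trans h2.symm))
  refine ⟨hd, F.map fun k => (k + d default) / l, fun s t i => ?_⟩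
  change ∀ᶠ k in (F : Filter ℤ), _
  filter_upwards [hY s i, hY t i] with k h1 h2
  rw [hd s default] at h1
  rw [hd t default] at h2
  rw [h1, h2, (heq s t).1]

/-- In a strong Toeplitz subshift of rank `K` any `K + 1` jointly proximal points have two equal
ones among them. -/
theorem exists_eq_of_proximal (hc : D.HasConstantLength) (hprim : D.IsPrimitive)
    (hprop : D.IsProper) (hrec : D.IsRecognizable) {K : ℕ} (hrank : D.alphabetRank ≤ K)
    {u : Fin (K + 1) → ℤ → D.A 0} (hu : ∀ s, u s ∈ D.points 0) (hprox : Proximal u) :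
    ∃ s t, s ≠ t ∧ u s = u t := by
  choose l hl using hc
  have step : ∀ n (u : Fin (K + 1) → ℤ → D.A n), (∀ s, u s ∈ D.points n) → Proximal u →
      ∃ (y : Fin (K + 1) → ℤ → D.A (n + 1)) (d : ℤ), ((∀ s, y s ∈ D.points (n + 1)) ∧ Proximal y) ∧
        ∀ s, (D.τ n).IsCenteredRepresentation (y s) d (u s) := by
    intro n u hu hprox
    choose y hy d hd using fun s => exists_isCenteredRepresentation hprim (hl n) (hu s)
    obtain ⟨h1, h2⟩ := proximal_of_isCenteredRepresentation (hl n) (hrec n) hprox hy hd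
    exact ⟨y, d 0, ⟨hy, h2⟩, fun s => h1 s 0 ▸ hd s⟩
  choose next d hnext hrep using step
  let S : ℕ → Type := fun n =>
    {u : Fin (K + 1) → ℤ → D.A n // (∀ s, u s ∈ D.points n) ∧ Proximal u}
  let seq : ∀ n, S n := Nat.rec ⟨u, hu, hprox⟩
    fun n p => ⟨next n p.1 p.2.1 p.2.2, hnext n p.1 p.2.1 p.2.2⟩
  have hseq : ∀ n, ∃ d : ℤ, ∀ s,
      (D.τ n).IsCenteredRepresentation ((seq (n + 1)).1 s) d ((seq n).1 s) :=
    fun n => ⟨d n (seq n).1 (seq n).2.1 (seq n).2.2, hrep n (seq n).1 (seq n).2.1 (seq n).2.2⟩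
  choose δ hδ using hseq
  -- There are finitely many pairs, so if each agreed at the origin at only finitely many levels,
  -- some level with at most `K` letters would separate all `K + 1` points.
  have hfreq : ∃ s t, s ≠ t ∧ ∃ᶠ n in atTop, (seq n).1 s 0 = (seq n).1 t 0 := by
    by_contra! hcon
    have h1 : ∀ᶠ n in atTop, ∀ s t, s ≠ t → ¬ (seq n).1 s 0 = (seq n).1 t 0 := by
      simp only [eventually_all]
      exact hcon
    obtain ⟨n, hn, hn'⟩ := ((frequently_le_of_liminf_le hrank).and_eventually h1).exists
    obtain ⟨s, t, hst, h⟩ := Fintype.exists_ne_map_eq_of_card_lt (fun s => (seq n).1 s 0)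
      (by simpa using Nat.lt_succ_of_le hn)
    exact hn' s t hst h
  obtain ⟨s, t, hst, hfreq⟩ := hfreq
  refine ⟨s, t, hst, ?_⟩
  have hval : ∀ n s m, (seq n).1 s m = (D.τ n).image ((seq (n + 1)).1 s) (δ n + m) := by
    intro n s m
    have := congrFun (hδ n s).1 m
    rwa [shift_apply] at this
  have hδl : ∀ n, 0 ≤ δ n ∧ δ n < l n := fun n => by
    have := (hδ n s).2
    rwa [hl] at this
  have hzero : ∀ n, (seq n).1 s 0 = (seq n).1 t 0 := by
    intro n
    obtain ⟨N, hN, h⟩ := hfreq.forall_exists_of_atTop n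
    induction N, hN using Nat.le_induction with
    | base => exact h
    | succ N hN ih =>
      apply ih
      rw [hval, hval]
      refine (D.τ N).image_congr (hl N) ?_ rfl
      rwa [add_zero, Int.ediv_eq_zero_of_lt (hδl N).1 (hδl N).2]
  have hwin : ∀ (N n : ℕ) (m : ℤ), -N ≤ m → m ≤ N → (seq n).1 s m = (seq n).1 t m := by
    intro N
    induction N with
    | zero =>
      intro n m h1 h2
      obtain rfl : m = 0 := by omega
      exact hzero n
    | succ N ih =>
      intro n m h1 h2
      rw [hval, hval]
      have hl0 : (0 : ℤ) < l n := by exact_mod_cast (D.τ n).length_pos (hl n)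
      have e1 := Int.emod_nonneg (δ n + m) hl0.ne'
      have e2 := Int.emod_lt_of_pos (δ n + m) hl0
      have e3 := Int.mul_ediv_add_emod (δ n + m) (l n)
      set q := (δ n + m) / (l n : ℤ) with hq
      set r := (δ n + m) % (l n : ℤ) with hr
      -- At the ends of a block properness fixes the letter. At an interior position the block index
      -- has absolute value at most `N`, so the induction hypothesis applies one level up.
      by_cases hr0 : r = 0 ∨ r = l n - 1
      · exact (D.τ n).image_congr_of_isProper (hl n) (hprop n) _ _ hr0
      · push Not at hr0
        have hd := hδl n
        refine (D.τ n).image_congr (hl n) (ih _ _ ?_ ?_) rfl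
        · rw [← hq]
          by_contra! hlt
          have : (l n : ℤ) * q ≤ l n * (-N - 1) := by
            apply mul_le_mul_of_nonneg_left _ hl0.le; omega
          push_cast at h1
          have h3 : (N : ℤ) * 1 ≤ N * l n := by
            apply mul_le_mul_of_nonneg_left _ (by omega); omega
          have : (l n : ℤ) * (-N - 1) = -(N * l n) - l n := by ring
          omega
        · rw [← hq]
          by_contra! hlt
          have : (l n : ℤ) * (N + 1) ≤ l n * q := by
            apply mul_le_mul_of_nonneg_left _ hl0.le; omega
          push_cast at h2
          have h3 : (N : ℤ) * 1 ≤ N * l n := by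
            apply mul_le_mul_of_nonneg_left _ (by omega); omega
          have : (l n : ℤ) * (N + 1) = N * l n + l n := by ring
          omega
  funext m
  exact hwin m.natAbs 0 m (by omega) (by omega)

end DirectiveSequence

/-! ### Bratteli-Vershik systems of rank one have no proximal pairs -/

instance (B : BratteliDiagram) (n : ℕ) : DiscreteTopology (B.E n) := ⟨rfl⟩

theorem BratteliDiagram.continuous_edge (B : BratteliDiagram) (n : ℕ) :
    Continuous fun e : B.PathSpace => e.1 n :=
  (continuous_apply n).comp continuous_subtype_val

namespace OrderedBratteliDiagram

variable {B : OrderedBratteliDiagram}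

theorem eq_of_isMin_of_src_eq {e f : B.PathSpace} {k : ℕ} (he : ∀ i < k, IsMin (e.1 i))
    (hf : ∀ i < k, IsMin (f.1 i)) (h : B.src (e.1 k) = B.src (f.1 k)) :
    ∀ i < k, e.1 i = f.1 i := by
  induction k with
  | zero => intro i hi; omega
  | succ k ih =>
    have hk : e.1 k = f.1 k :=
      isMin_unique (he k (by omega)) (hf k (by omega)) (by rw [e.2, f.2, h])
    intro i hi
    rcases Nat.lt_succ_iff_lt_or_eq.1 hi with hi | rfl
    · exact ih (fun j hj => he j (by omega)) (fun j hj => hf j (by omega)) (by rw [hk]) i hi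
    · exact hk

theorem VershikStep.isMin {e e' : B.PathSpace} (h : B.VershikStep e e') {n : ℕ}
    (he : ∀ i < n, IsMax (e.1 i)) : ∀ i < n, IsMin (e'.1 i) := by
  rcases h with ⟨-, h⟩ | ⟨k, -, hk, -, hmin, -⟩
  · exact fun i _ => h i
  · have : n ≤ k := by
      by_contra! hlt
      exact hk (he k hlt)
    exact fun i hi => hmin i (by omega)

theorem VershikStep.of_not_isMax {e e' : B.PathSpace} (h : B.VershikStep e e') {k : ℕ}
    (he : ∀ i < k, IsMax (e.1 i)) (hk : ¬ IsMax (e.1 k)) :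
    e.1 k ⋖ e'.1 k ∧ ∀ i, k < i → e'.1 i = e.1 i := by
  rcases h with ⟨h, -⟩ | ⟨k', h1, h2, h3, -, h5⟩
  · exact absurd (h k) hk
  · obtain rfl : k' = k := by
      rcases lt_trichotomy k' k with hlt | heq | hlt
      · exact absurd (he k' hlt) h2
      · exact heq
      · exact absurd (h1 k hlt) hk
    exact ⟨h3, h5⟩

/-- If the first `n` edges are all maximal, the image begins with the minimal path into the only
vertex of level `n`; otherwise the map changes only edges below level `n`, and does so as those
edges dictate. -/
theorem vershikMap_eq_of_subsingleton (hB : B.IsProperlyOrdered) {n : ℕ} [Subsingleton (B.V n)]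
    {e f : B.PathSpace} (h : ∀ i < n, e.1 i = f.1 i) :
    ∀ i < n, (vershikMap hB e).1 i = (vershikMap hB f).1 i := by
  classical
  have he := vershikMap_spec hB e
  have hf := vershikMap_spec hB f
  by_cases hmax : ∀ i < n, IsMax (e.1 i)
  · exact eq_of_isMin_of_src_eq (he.isMin hmax)
      (hf.isMin fun i hi => h i hi ▸ hmax i hi) (Subsingleton.elim _ _)
  · push Not at hmax
    obtain ⟨hkn, hk⟩ := Nat.find_spec hmax
    have hlt : ∀ i < Nat.find hmax, IsMax (e.1 i) := fun i hi =>
      not_not.1 fun hc => Nat.find_min hmax hi ⟨hi.trans hkn, hc⟩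
    set k := Nat.find hmax
    have hltf : ∀ i < k, IsMax (f.1 i) := fun i hi => h i (hi.trans hkn) ▸ hlt i hi
    obtain ⟨e1, e2⟩ := he.of_not_isMax hlt hk
    obtain ⟨f1, f2⟩ := hf.of_not_isMax hltf (h k hkn ▸ hk)
    have hkk : (vershikMap hB e).1 k = (vershikMap hB f).1 k :=
      covBy_unique e1 (by rw [h k hkn]; exact f1)
    intro i hi
    rcases lt_trichotomy i k with hik | rfl | hik
    · exact eq_of_isMin_of_src_eq (he.isMin hlt) (hf.isMin hltf) (by rw [hkk]) i hik
    · exact hkk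
    · rw [e2 i hik, f2 i hik, h i hi]

theorem eq_of_rank_le_one (hB : B.IsProperlyOrdered) (hr : B.rank ≤ 1) {X : Type*}
    [TopologicalSpace X] {T : X ≃ₜ X} (hT : Conjugate T (vershikMap hB)) {F : Ultrafilter ℕ}
    {x y z : X} (hx : Tendsto (fun k => T.symm^[k] x) F (𝓝 z))
    (hy : Tendsto (fun k => T.symm^[k] y) F (𝓝 z)) : x = y := by
  obtain ⟨h, hh⟩ := hT
  have hfreq : ∃ᶠ n in atTop, Fintype.card (B.V n) ≤ 1 :=
    frequently_le_of_liminf_le (K := 1) (by simpa [BratteliDiagram.rank] using hr)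
  have hback : ∀ (w : X) (k : ℕ), (vershikMap hB)^[k] (h (T.symm^[k] w)) = h w := by
    intro w k
    rw [← (hh.iterate_right k).eq, Function.LeftInverse.iterate T.apply_symm_apply k w]
  have hev : ∀ {w : X}, Tendsto (fun k => T.symm^[k] w) F (𝓝 z) → ∀ i,
      ∀ᶠ k in (F : Filter ℕ), (h (T.symm^[k] w)).1 i = (h z).1 i := by
    intro w hw i
    have := ((B.continuous_edge i).comp h.continuous).continuousAt.tendsto.comp hw
    rw [nhds_discrete, tendsto_pure] at this
    exact this
  -- Far back along `F` both orbits share their first `n` edges with the limit; applying the map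
  -- forward `k` times preserves this agreement.
  have key : ∀ n, Fintype.card (B.V n) ≤ 1 → ∀ i < n, (h x).1 i = (h y).1 i := by
    intro n hn
    have : Subsingleton (B.V n) := Fintype.card_le_one_iff_subsingleton.1 hn
    have h1 : ∀ᶠ k in (F : Filter ℕ), ∀ i ∈ Set.Iio n,
        (h (T.symm^[k] x)).1 i = (h (T.symm^[k] y)).1 i :=
      (eventually_all_finite (Set.finite_Iio n)).2 fun i _ => by
        filter_upwards [hev hx i, hev hy i] with k h1 h2
        rw [h1, h2]
    obtain ⟨k, hk⟩ := h1.exists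
    have h2 : ∀ j, ∀ i < n, ((vershikMap hB)^[j] (h (T.symm^[k] x))).1 i =
        ((vershikMap hB)^[j] (h (T.symm^[k] y))).1 i := by
      intro j
      induction j with
      | zero => exact hk
      | succ j ih =>
        simp only [Function.iterate_succ_apply']
        exact vershikMap_eq_of_subsingleton hB ih
    simpa only [hback] using h2 k
  apply h.injective
  apply Subtype.ext
  funext i
  obtain ⟨n, hn, hcard⟩ := hfreq.forall_exists_of_atTop (i + 1)
  exact key n hcard i (by omega)

end OrderedBratteliDiagram

/-! ### Transfer of proximality through a conjugacy -/

theorem shiftHomeo_symm_iterate {A : Type*} [TopologicalSpace A] (X : Subshift A ℤ)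
    (x : X.carrier) (k : ℕ) (i : ℤ) :
    ((shiftHomeo X).symm^[k] x).1 i = x.1 (-k + i) := by
  induction k generalizing i with
  | zero => simp
  | succ k ih =>
    rw [Function.iterate_succ_apply']
    change ((shiftHomeo X).symm^[k] x).1 (-1 + i) = _
    rw [ih]
    exact congrArg x.1 (by push_cast; ring)

theorem not_isStrongToeplitz {A : Type*} [TopologicalSpace A] {X : Subshift A ℤ} {K : ℕ}
    {F : Ultrafilter ℕ} {x : Fin (K + 1) → X.carrier} {z : X.carrier}
    (hx : ∀ s, Tendsto (fun k => (shiftHomeo X).symm^[k] (x s)) F (𝓝 z))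
    (hinj : Function.Injective x) : ¬ IsStrongToeplitz X K := by
  rintro ⟨D, h1, h2, h3, h4, h5, h, hh⟩
  have hsymm : Function.Semiconj h (shiftHomeo X).symm (shiftHomeo (D.levelSubshift 0)).symm := by
    intro w
    apply (shiftHomeo (D.levelSubshift 0)).injective
    rw [← hh.eq, Homeomorph.apply_symm_apply, Homeomorph.apply_symm_apply]
  obtain ⟨s, t, hst, heq⟩ := D.exists_eq_of_proximal h1 h2 h3 h4 h5
    (u := fun s => (h (x s)).1) (fun s => (h (x s)).2)
    ⟨F.map fun k : ℕ => -(k : ℤ), fun s t i => by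
      change ∀ᶠ k in (F : Filter ℕ), _
      have hev : ∀ s, ∀ᶠ k : ℕ in F, (h (x s)).1 (-(k : ℤ) + i) = (h z).1 i := by
        intro s
        have hc : Continuous fun w : X.carrier => (h w).1 i :=
          (continuous_apply i).comp (continuous_subtype_val.comp h.continuous)
        have := hc.continuousAt.tendsto.comp (hx s)
        rw [nhds_discrete, tendsto_pure] at this
        filter_upwards [this] with k hk
        rw [← hk, Function.comp_apply, (hsymm.iterate_right k).eq, shiftHomeo_symm_iterate]
      filter_upwards [hev s, hev t] with k hs ht
      rw [hs, ht]⟩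
  exact hst (hinj (h.injective (Subtype.ext heq)))

/-! ### A Toeplitz substitution of length seven

On the letters `0, 1, 2` we use `0 ↦ 0000012`, `1 ↦ 0001212`, `2 ↦ 0012012`. In its subshift
every `1` is followed by `2` and every `2` is preceded by `1`. -/

/-- The letter at position `j` of the image of the letter `s`. -/
def letter : Fin 3 → Fin 7 → Fin 3 :=
  ![![0, 0, 0, 0, 0, 1, 2], ![0, 0, 0, 1, 2, 1, 2], ![0, 0, 1, 2, 0, 1, 2]]

def residue (m : ℤ) : Fin 7 := ⟨(m % 7).toNat, by omega⟩

theorem residue_mul_add (q : ℤ) (r : Fin 7) : residue (7 * q + r) = r := by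
  apply Fin.ext
  simp only [residue]
  omega

def substitute (y : ℤ → Fin 3) (m : ℤ) : Fin 3 := letter (y (m / 7)) (residue m)

theorem substitute_mul_add (y : ℤ → Fin 3) (q : ℤ) (r : Fin 7) :
    substitute y (7 * q + r) = letter (y q) r := by
  rw [substitute, residue_mul_add]
  congr 2
  omega

theorem substitute_of_eq (y : ℤ → Fin 3) {m : ℤ} (q : ℤ) (r : Fin 7) (h : m = 7 * q + r) :
    substitute y m = letter (y q) r := by
  rw [h, substitute_mul_add]

theorem exists_eq_mul_add (m : ℤ) : ∃ (q : ℤ) (r : Fin 7), m = 7 * q + r :=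
  ⟨m / 7, residue m, by simp only [residue]; omega⟩

theorem substitute_shift (k : ℤ) (y : ℤ → Fin 3) :
    substitute (shift k y) = shift (7 * k) (substitute y) := by
  funext m
  obtain ⟨q, r, rfl⟩ := exists_eq_mul_add m
  rw [substitute_mul_add, shift_apply, shift_apply, substitute_of_eq y (k + q) r (by ring)]

theorem continuous_substitute : Continuous substitute :=
  continuous_pi fun m =>
    (continuous_of_discreteTopology (f := fun s => letter s (residue m))).comp
      (continuous_apply (m / 7))

/-- The block containing the origin starts at `-d` for the unique `d` with `200` at `-d - 1`. -/
def findMarker (u : Fin 7 → Fin 3 × Fin 3 × Fin 3) : Fin 7 :=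
  if h : ∃ d, u d = (2, 0, 0) then h.choose else 0

/-- The position of the origin in its block. -/
def digit (x : ℤ → Fin 3) : Fin 7 :=
  findMarker fun d => (x (-d - 1), x (-d), x (-d + 1))

/-- The point `y` with `x = shift (digit x) (substitute y)`. -/
def desubstitute (x : ℤ → Fin 3) (i : ℤ) : Fin 3 := x (7 * i + 3 - digit x)

theorem continuous_digit : Continuous digit :=
  (continuous_of_discreteTopology (f := findMarker)).comp (by fun_prop)

theorem continuous_desubstitute : Continuous desubstitute := by
  refine continuous_pi fun i => ?_
  have h : Continuous fun p : (ℤ → Fin 3) × Fin 7 => p.1 (7 * i + 3 - p.2) :=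
    continuous_prod_of_discrete_right.2 fun d => continuous_apply (7 * i + 3 - (d : ℤ))
  exact h.comp (continuous_id.prodMk continuous_digit)

/-- Every block starts with `00` and ends with `2`, and `200` never occurs inside a block, so the
word marks exactly the block boundaries. -/
theorem marker_iff (y : ℤ → Fin 3) (i : ℤ) :
    (substitute y (i - 1), substitute y i, substitute y (i + 1)) = ((2, 0, 0) : _ × _ × _) ↔
      i % 7 = 0 := by
  obtain ⟨q, r, rfl⟩ := exists_eq_mul_add i
  rw [substitute_mul_add]
  by_cases h0 : r = 0
  · subst h0
    rw [substitute_of_eq y (q - 1) 6 (by norm_num; ring), substitute_of_eq y q 1 (by norm_num)]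
    have : ∀ s s', (letter s 6, letter s' 0, letter s' 1) = (2, 0, 0) := by decide
    simp [this]
  · refine iff_of_false ?_ (by omega)
    by_cases h6 : r = 6
    · subst h6
      have : ∀ s, letter s 6 ≠ 0 := by decide
      simp [this]
    · have key : ∀ s (r : Fin 7), r ≠ 0 → r ≠ 6 →
        ¬ (letter s (r - 1), letter s r, letter s (r + 1)) = (2, 0, 0) := by decide
      rw [substitute_of_eq y q (r - 1), substitute_of_eq y q (r + 1)]
      · exact key _ _ h0 h6
      · rw [Fin.val_add_one_of_lt (Fin.lt_last_iff_ne_last.2 h6)]; push_cast; ring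
      · rw [Fin.val_sub_one_of_ne_zero h0]; omega

theorem digit_shift_substitute (d : Fin 7) (y : ℤ → Fin 3) :
    digit (shift d (substitute y)) = d := by
  have h : ∀ d' : Fin 7, (shift (d : ℤ) (substitute y) (-d' - 1),
      shift (d : ℤ) (substitute y) (-d'), shift (d : ℤ) (substitute y) (-d' + 1)) =
        ((2, 0, 0) : _ × _ × _) ↔ d' = d := by
    intro d'
    have := marker_iff y (d - d')
    simp only [shift_apply]
    rw [show (d : ℤ) + (-d' - 1) = d - d' - 1 by ring, show (d : ℤ) + (-d' + 1) = d - d' + 1 by ring,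
      ← sub_eq_add_neg, this]
    omega
  have hex : ∃ d' : Fin 7, (shift (d : ℤ) (substitute y) (-d' - 1),
      shift (d : ℤ) (substitute y) (-d'), shift (d : ℤ) (substitute y) (-d' + 1)) =
        ((2, 0, 0) : _ × _ × _) := ⟨d, (h d).2 rfl⟩
  rw [digit, findMarker, dif_pos hex]
  exact (h _).1 hex.choose_spec

theorem desubstitute_shift_substitute (d : Fin 7) (y : ℤ → Fin 3) :
    desubstitute (shift d (substitute y)) = y := by
  funext i
  rw [desubstitute, digit_shift_substitute, shift_apply,
    substitute_of_eq y i 3 (by norm_num)]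
  have : ∀ s, letter s 3 = s := by decide
  exact this _

/-! ### Points fixed by substituting and shifting -/

/-- The point `x` with `x 0 = s` and `x = shift d (substitute x)`, for `1 ≤ d ≤ 5`. -/
def fixedPt (d : ℤ) (s : Fin 3) (m : ℤ) : Fin 3 :=
  if ((d + m) / 7).natAbs < m.natAbs then
    letter (fixedPt d s ((d + m) / 7)) (residue (d + m))
  else s
termination_by m.natAbs

theorem fixedPt_zero (d : ℤ) (s : Fin 3) : fixedPt d s 0 = s := by
  rw [fixedPt]
  simp

theorem fixedPt_eq {d : Fin 7} (h1 : 1 ≤ d) (h5 : d ≤ 5) {s : Fin 3} (hs : letter s d = s) :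
    fixedPt d s = shift (d : ℤ) (substitute (fixedPt d s)) := by
  funext m
  rw [shift_apply]
  by_cases hm : m = 0
  · rw [hm, substitute_of_eq _ 0 d (by ring), fixedPt_zero, hs]
  · have h1' : 1 ≤ d.1 := h1
    have h5' : d.1 ≤ 5 := h5
    rw [fixedPt, if_pos (by omega), substitute]

/-- A Toeplitz sequence. -/
def toeplitzPt : ℤ → Fin 3 := fixedPt 1 0

theorem toeplitzPt_eq : toeplitzPt = shift 1 (substitute toeplitzPt) :=
  fixedPt_eq (d := 1) (by decide) (by decide) (by decide)

theorem toeplitzPt_apply (m : ℤ) : toeplitzPt m = substitute toeplitzPt (1 + m) :=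
  congrFun toeplitzPt_eq m

theorem isToeplitzSequence_toeplitzPt : IsToeplitzSequence toeplitzPt := by
  intro i
  induction hn : i.natAbs using Nat.strong_induction_on generalizing i with
  | _ n ih =>
    by_cases hi : i = 0
    · refine ⟨7, by norm_num, fun k => ?_⟩
      rw [toeplitzPt_apply, toeplitzPt_apply, hi,
        substitute_of_eq _ k 1 (by push_cast [Fin.val_one]; ring),
        substitute_of_eq _ 0 1 (by simp)]
      have : ∀ s s', letter s 1 = letter s' 1 := by decide
      exact this _ _
    -- A period of the letter that generates the block, multiplied by 7, is a period here; the base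
    -- case uses that column 1 is constant.
    · obtain ⟨p, hp, h⟩ := ih ((1 + i) / 7).natAbs (by omega) ((1 + i) / 7) rfl
      refine ⟨7 * p, by omega, fun k => ?_⟩
      obtain ⟨q, r, hqr⟩ := exists_eq_mul_add (1 + i)
      have hq : (1 + i) / 7 = q := by omega
      rw [hq] at h
      rw [toeplitzPt_apply, toeplitzPt_apply, substitute_of_eq _ q r hqr,
        substitute_of_eq _ (q + k * p) r (by push_cast; linarith), h]

/-! ### The subshift -/

/-- The orbit closure of `toeplitzPt`. -/
def toeplitzShift : Subshift (Fin 3) ℤ where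
  carrier := closure (Set.range fun k : ℤ => shift k toeplitzPt)
  isClosed := isClosed_closure
  mapsTo g := by
    refine Set.MapsTo.closure ?_ (continuous_shift g)
    rintro _ ⟨k, rfl⟩
    refine ⟨g + k, ?_⟩
    funext i
    simp only [shift_apply]
    congr 1
    ring

theorem mem_toeplitzShift_iff {x : ℤ → Fin 3} : x ∈ toeplitzShift.carrier ↔
    ∀ N : ℕ, ∃ k : ℤ, ∀ i : ℤ, -N ≤ i → i ≤ N → toeplitzPt (k + i) = x i := by
  constructor
  · intro hx N
    have hopen := isOpen_cylinder (Finset.Icc (-(N : ℤ)) N) x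
    obtain ⟨_, h, k, rfl⟩ := mem_closure_iff.1 hx _ hopen (by simp [mem_cylinder])
    refine ⟨k, fun i h1 h2 => ?_⟩
    have := mem_cylinder.1 h i (by simp [h1, h2])
    simpa using this
  · intro h
    choose k hk using h
    refine mem_closure_of_tendsto (b := atTop) (f := fun N => shift (k N) toeplitzPt)
      (tendsto_pi_nhds.2 fun i => ?_) (Eventually.of_forall fun N => ⟨k N, rfl⟩)
    rw [nhds_discrete, tendsto_pure]
    filter_upwards [eventually_ge_atTop i.natAbs] with N hN
    exact hk N i (by omega) (by omega)

theorem toeplitzPt_mem : toeplitzPt ∈ toeplitzShift.carrier :=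
  subset_closure ⟨0, by simp⟩

theorem mem_toeplitzShift_of_approx {x : ℤ → Fin 3}
    (h : ∀ N : ℕ, ∃ y ∈ toeplitzShift.carrier, ∀ i : ℤ, -N ≤ i → i ≤ N → y i = x i) :
    x ∈ toeplitzShift.carrier := by
  rw [mem_toeplitzShift_iff]
  intro N
  obtain ⟨y, hy, hyx⟩ := h N
  obtain ⟨k, hk⟩ := mem_toeplitzShift_iff.1 hy N
  exact ⟨k, fun i h1 h2 => (hk i h1 h2).trans (hyx i h1 h2)⟩

theorem shift_shift (a b : ℤ) (y : ℤ → Fin 3) : shift a (shift b y) = shift (a + b) y := by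
  funext i
  simp only [shift_apply]
  congr 1
  ring

theorem substitute_mem {y : ℤ → Fin 3} (hy : y ∈ toeplitzShift.carrier) :
    substitute y ∈ toeplitzShift.carrier := by
  refine Set.MapsTo.closure ?_ continuous_substitute hy
  rintro _ ⟨k, rfl⟩
  refine ⟨7 * k - 1, ?_⟩
  beta_reduce
  conv_lhs => rw [toeplitzPt_eq]
  rw [shift_shift, substitute_shift, sub_add_cancel]

/-- The right-hand sides form a finite union of compact images, which is closed and contains the
orbit of `toeplitzPt`. -/
theorem exists_eq_shift_substitute {x : ℤ → Fin 3} (hx : x ∈ toeplitzShift.carrier) :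
    ∃ y ∈ toeplitzShift.carrier, ∃ d : Fin 7, x = shift (d : ℤ) (substitute y) := by
  have hclosed : IsClosed (⋃ d : Fin 7,
      (fun y => shift (d : ℤ) (substitute y)) '' toeplitzShift.carrier) :=
    isClosed_iUnion_of_finite fun d => (toeplitzShift.isClosed.isCompact.image
      ((continuous_shift _).comp continuous_substitute)).isClosed
  have hsub : Set.range (fun k : ℤ => shift k toeplitzPt) ⊆ ⋃ d : Fin 7,
      (fun y => shift (d : ℤ) (substitute y)) '' toeplitzShift.carrier := by
    rintro _ ⟨k, rfl⟩
    obtain ⟨q, r, hqr⟩ := exists_eq_mul_add (k + 1)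
    refine Set.mem_iUnion.2 ⟨r, shift q toeplitzPt, toeplitzShift.mapsTo q toeplitzPt_mem, ?_⟩
    beta_reduce
    conv_rhs => rw [toeplitzPt_eq]
    rw [substitute_shift, shift_shift, shift_shift, hqr, add_comm]
  obtain ⟨d, y, hy, h⟩ := Set.mem_iUnion.1 (closure_minimal hsub hclosed hx)
  exact ⟨y, hy, d, h.symm⟩

theorem desubstitute_mem {x : ℤ → Fin 3} (hx : x ∈ toeplitzShift.carrier) :
    desubstitute x ∈ toeplitzShift.carrier := by
  obtain ⟨y, hy, d, rfl⟩ := exists_eq_shift_substitute hx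
  rwa [desubstitute_shift_substitute]

theorem shift_digit_substitute {x : ℤ → Fin 3} (hx : x ∈ toeplitzShift.carrier) :
    shift (digit x : ℤ) (substitute (desubstitute x)) = x := by
  obtain ⟨y, hy, d, rfl⟩ := exists_eq_shift_substitute hx
  rw [desubstitute_shift_substitute, digit_shift_substitute]

theorem apply_eq_substitute {x : ℤ → Fin 3} (hx : x ∈ toeplitzShift.carrier) (m : ℤ) :
    x m = substitute (desubstitute x) (digit x + m) :=
  (congrFun (shift_digit_substitute hx) m).symm

theorem apply_zero_eq_letter {x : ℤ → Fin 3} (hx : x ∈ toeplitzShift.carrier) :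
    x 0 = letter (desubstitute x 0) (digit x) := by
  rw [apply_eq_substitute hx, substitute_of_eq _ 0 (digit x) (by ring)]

/-- Together with `digit_shift_of_eq`, this describes the shift as an odometer: the digit advances,
and at 6 it resets and carries to the desubstituted point. -/
theorem digit_shift_of_ne {x : ℤ → Fin 3} (hx : x ∈ toeplitzShift.carrier) (h : digit x ≠ 6) :
    digit (shift 1 x) = digit x + 1 ∧ desubstitute (shift 1 x) = desubstitute x := by
  obtain ⟨y, hy, d, rfl⟩ := exists_eq_shift_substitute hx
  rw [digit_shift_substitute] at h
  have h1 : shift (1 : ℤ) (shift (d : ℤ) (substitute y)) =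
      shift ((d + 1 : Fin 7) : ℤ) (substitute y) := by
    rw [shift_shift, Fin.val_add_one_of_lt (Fin.lt_last_iff_ne_last.2 h), add_comm]
    rfl
  rw [h1]
  simp only [digit_shift_substitute, desubstitute_shift_substitute, and_self]

theorem digit_shift_of_eq {x : ℤ → Fin 3} (hx : x ∈ toeplitzShift.carrier) (h : digit x = 6) :
    digit (shift 1 x) = 0 ∧ desubstitute (shift 1 x) = shift 1 (desubstitute x) := by
  obtain ⟨y, hy, d, rfl⟩ := exists_eq_shift_substitute hx
  rw [digit_shift_substitute] at h
  subst h
  have h1 : shift (1 : ℤ) (shift ((6 : Fin 7) : ℤ) (substitute y)) =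
      shift ((0 : Fin 7) : ℤ) (substitute (shift 1 y)) := by
    rw [substitute_shift, shift_shift, shift_shift]
    rfl
  rw [h1]
  simp only [digit_shift_substitute, desubstitute_shift_substitute, and_self]

theorem apply_eq_one_iff {x : ℤ → Fin 3} (hx : x ∈ toeplitzShift.carrier) (i : ℤ) :
    x i = 1 ↔ x (i + 1) = 2 := by
  rw [apply_eq_substitute hx, apply_eq_substitute hx]
  obtain ⟨q, r, hqr⟩ := exists_eq_mul_add (digit x + i)
  rw [substitute_of_eq _ q r hqr]
  by_cases h6 : r = 6
  · subst h6
    rw [substitute_of_eq _ (q + 1) 0 (by rw [← add_assoc, hqr]; norm_num; ring)]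
    have : ∀ s s', letter s 6 = 1 ↔ letter s' 0 = 2 := by decide
    exact this _ _
  · rw [substitute_of_eq _ q (r + 1) (by
      rw [Fin.val_add_one_of_lt (Fin.lt_last_iff_ne_last.2 h6)]; push_cast; linarith)]
    have : ∀ s (r : Fin 7), r ≠ 6 → (letter s r = 1 ↔ letter s (r + 1) = 2) := by decide
    exact this _ _ h6

theorem exists_apply_zero_eq (s : Fin 3) : ∃ y ∈ toeplitzShift.carrier, y 0 = s := by
  have h0 : toeplitzPt 0 = 0 := fixedPt_zero 1 0
  have h : ∀ r : Fin 7, ∃ y ∈ toeplitzShift.carrier, y 0 = letter 0 r := by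
    intro r
    refine ⟨shift (r - 1 : ℤ) toeplitzPt, toeplitzShift.mapsTo _ toeplitzPt_mem, ?_⟩
    rw [shift_apply, toeplitzPt_apply, substitute_of_eq _ 0 r (by ring), h0]
  have : ∀ s, ∃ r, letter 0 r = s := by decide
  obtain ⟨r, rfl⟩ := this s
  exact h r

/-! ### Minimality -/

theorem exists_period (N : ℕ) : ∃ p : ℕ, 1 ≤ p ∧ ∀ i : ℤ, -N ≤ i → i ≤ N → ∀ k : ℤ,
    toeplitzPt (i + k * p) = toeplitzPt i := by
  choose p hp h using isToeplitzSequence_toeplitzPt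
  refine ⟨∏ i ∈ Finset.Icc (-(N : ℤ)) N, p i, Nat.succ_le_of_lt (Finset.prod_pos fun i _ => hp i),
    fun i h1 h2 k => ?_⟩
  obtain ⟨c, hc⟩ := Finset.dvd_prod_of_mem p (Finset.mem_Icc.2 ⟨h1, h2⟩)
  rw [hc, ← h i (k * c)]
  congr 1
  push_cast
  ring

/-- The central window of `toeplitzPt` recurs with some period `p`, so any window enlarged by `p`
contains a copy of it. This uniform recurrence gives minimality. -/
theorem exists_shift_eq_toeplitzPt {x : ℤ → Fin 3} (hx : x ∈ toeplitzShift.carrier) (N : ℕ) :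
    ∃ t : ℤ, ∀ i : ℤ, -N ≤ i → i ≤ N → x (t + i) = toeplitzPt i := by
  obtain ⟨p, hp, h⟩ := exists_period N
  obtain ⟨k, hk⟩ := mem_toeplitzShift_iff.1 hx (N + p)
  have hp0 : (0 : ℤ) < p := by omega
  refine ⟨(-k) % p, fun i h1 h2 => ?_⟩
  have e1 := Int.emod_nonneg (-k) hp0.ne'
  have e2 := Int.emod_lt_of_pos (-k) hp0
  have e3 := Int.mul_ediv_add_emod (-k) p
  rw [← hk _ (by push_cast; omega) (by push_cast; omega), ← h i h1 h2 (-(-k / p))]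
  congr 1
  linarith

/-- Infinite descent: a period of `x` must preserve the digit, hence is divisible by 7, and its
quotient is a smaller period of the desubstituted point. -/
theorem shift_ne_self {x : ℤ → Fin 3} (hx : x ∈ toeplitzShift.carrier) {m : ℤ} (hm : m ≠ 0) :
    shift m x ≠ x := by
  intro h
  induction hn : m.natAbs using Nat.strong_induction_on generalizing m x with
  | _ n ih =>
    obtain ⟨y, hy, d, rfl⟩ := exists_eq_shift_substitute hx
    obtain ⟨q, r, hqr⟩ := exists_eq_mul_add (m + d)
    have h1 : shift (r : ℤ) (substitute (shift q y)) = shift (d : ℤ) (substitute y) := by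
      rw [← h, substitute_shift, shift_shift, shift_shift, hqr, add_comm]
    have hd : r = d := by
      have := congrArg digit h1
      rwa [digit_shift_substitute, digit_shift_substitute] at this
    have hy' : shift q y = y := by
      have := congrArg desubstitute h1
      rwa [desubstitute_shift_substitute, desubstitute_shift_substitute] at this
    subst hd
    exact ih q.natAbs (by omega) hy (by omega) hy' rfl

theorem coe_shiftHomeo_zpow {A : Type*} [TopologicalSpace A] (X : Subshift A ℤ) (k : ℤ)
    (x : X.carrier) : ((shiftHomeo X ^ k) x).1 = shift k x.1 := by
  induction k using Int.induction_on generalizing x with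
  | zero => simp
  | succ n ih =>
    rw [zpow_add_one, Homeomorph.mul_apply, ih]
    funext i
    exact congrArg x.1 (by ring)
  | pred n ih =>
    rw [zpow_sub_one, Homeomorph.mul_apply, ih]
    funext i
    exact congrArg x.1 (by ring)

instance : CompactSpace toeplitzShift.carrier :=
  isCompact_iff_compactSpace.1 toeplitzShift.isClosed.isCompact

theorem dense_orbit (x : toeplitzShift.carrier) :
    Dense (Set.range fun k : ℤ => (shiftHomeo toeplitzShift ^ k) x) := by
  intro z
  rw [closure_subtype, ← Set.range_comp]
  have hz := mem_toeplitzShift_iff.1 z.2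
  choose k hk using hz
  choose t ht using fun N => exists_shift_eq_toeplitzPt x.2 (N + (k N).natAbs)
  refine mem_closure_of_tendsto (b := atTop) (f := fun N : ℕ => shift (t N + k N) x.1)
    (tendsto_pi_nhds.2 fun i => ?_)
    (Eventually.of_forall fun N => ⟨t N + k N, coe_shiftHomeo_zpow _ _ _⟩)
  rw [nhds_discrete, tendsto_pure]
  filter_upwards [eventually_ge_atTop i.natAbs] with N hN
  rw [shift_apply, add_assoc, ht N _ (by omega) (by omega)]
  exact hk N i (by omega) (by omega)

theorem perfectSpace_toeplitzShift : PerfectSpace toeplitzShift.carrier := by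
  rw [perfectSpace_iff_forall_not_isolated]
  intro z
  have h : ∀ N : ℕ, ∃ y : toeplitzShift.carrier, y ≠ z ∧
      ∀ i : ℤ, -N ≤ i → i ≤ N → y.1 i = z.1 i := by
    intro N
    obtain ⟨k, hk⟩ := mem_toeplitzShift_iff.1 z.2 N
    obtain ⟨p, hp, hper⟩ := exists_period (N + k.natAbs)
    let y : toeplitzShift.carrier := ⟨shift k toeplitzPt, toeplitzShift.mapsTo k toeplitzPt_mem⟩
    by_cases hyz : y = z
    -- If the approximating translate is `z` itself, translating by a further period keeps the
    -- window, and aperiodicity makes the point different.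
    · refine ⟨⟨shift p y.1, toeplitzShift.mapsTo _ y.2⟩, fun h => ?_, fun i h1 h2 => ?_⟩
      · rw [← hyz] at h
        exact shift_ne_self y.2 (m := p) (by omega) (congrArg Subtype.val h)
      · rw [← hk i h1 h2, ← hper (k + i) (by omega) (by omega) 1]
        exact congrArg toeplitzPt (by ring)
    · exact ⟨y, hyz, hk⟩
  choose y hy hyz using h
  have : Tendsto y atTop (𝓝[≠] z) := by
    refine tendsto_nhdsWithin_iff.2 ⟨?_, Eventually.of_forall hy⟩
    refine tendsto_subtype_rng.2 (tendsto_pi_nhds.2 fun i => ?_)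
    rw [nhds_discrete, tendsto_pure]
    filter_upwards [eventually_ge_atTop i.natAbs] with N hN
    exact hyz N i (by omega) (by omega)
  exact this.neBot

theorem isMinimalCantorSystem_toeplitzShift :
    IsMinimalCantorSystem (shiftHomeo toeplitzShift) where
  nonempty := ⟨⟨_, toeplitzPt_mem⟩⟩
  compact := inferInstance
  metrizable := inferInstance
  zeroDimensional := inferInstance
  perfect := perfectSpace_toeplitzShift
  minimal := dense_orbit

/-! ### Three proximal points -/

theorem fixedPt_three_apply (s : Fin 3) (m : ℤ) :
    fixedPt 3 s m = substitute (fixedPt 3 s) (3 + m) := by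
  have h3 : ∀ s, letter s 3 = s := by decide
  exact congrFun (fixedPt_eq (d := 3) (by decide) (by decide) (h3 s)) m

theorem fixedPt_three_mem (s : Fin 3) : fixedPt 3 s ∈ toeplitzShift.carrier := by
  refine mem_toeplitzShift_of_approx fun N => ?_
  induction N with
  | zero =>
    obtain ⟨y, hy, h⟩ := exists_apply_zero_eq s
    refine ⟨y, hy, fun i h1 h2 => ?_⟩
    obtain rfl : i = 0 := by omega
    rw [h, fixedPt_zero]
  | succ N ih =>
    obtain ⟨y, hy, h⟩ := ih
    refine ⟨shift 3 (substitute y), toeplitzShift.mapsTo 3 (substitute_mem hy), fun i h1 h2 => ?_⟩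
    rw [shift_apply, fixedPt_three_apply, substitute, substitute, h _ (by omega) (by omega)]

/-- Position `-3` lies in the constant column 0, and each substitution step turns a window of
agreement around `-p` into a larger one around `-7p`; thus `p = 3 * 7 ^ N`. -/
theorem exists_fixedPt_three_agree (N : ℕ) : ∃ p : ℕ, ∀ (s t : Fin 3) (i : ℤ), -N ≤ i → i ≤ N →
    fixedPt 3 s (-p + i) = fixedPt 3 t (-p + i) := by
  induction N with
  | zero =>
    refine ⟨3, fun s t i h1 h2 => ?_⟩
    obtain rfl : i = 0 := by omega
    have : ∀ s t, letter s 0 = letter t 0 := by decide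
    rw [fixedPt_three_apply, fixedPt_three_apply, substitute_of_eq _ 0 0 (by norm_num),
      substitute_of_eq _ 0 0 (by norm_num), this]
  | succ N ih =>
    obtain ⟨p, hp⟩ := ih
    refine ⟨7 * p, fun s t i h1 h2 => ?_⟩
    rw [fixedPt_three_apply, fixedPt_three_apply, substitute, substitute,
      show (3 + (-((7 * p : ℕ) : ℤ) + i)) / 7 = -p + (3 + i) / 7 by omega,
      hp s t _ (by omega) (by omega)]

def proximalPt (s : Fin 3) : toeplitzShift.carrier := ⟨fixedPt 3 s, fixedPt_three_mem s⟩

theorem proximalPt_injective : Function.Injective proximalPt := by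
  intro s t h
  have : fixedPt 3 s 0 = fixedPt 3 t 0 := congrArg (fun x => x.1 0) h
  rwa [fixedPt_zero, fixedPt_zero] at this

theorem exists_tendsto_proximalPt : ∃ (F : Ultrafilter ℕ) (z : toeplitzShift.carrier), ∀ s,
    Tendsto (fun k => (shiftHomeo toeplitzShift).symm^[k] (proximalPt s)) F (𝓝 z) := by
  choose p hp using exists_fixedPt_three_agree
  -- Compactness gives a limit for the letter 0 along the positions `p N`; agreement on growing
  -- windows gives the other letters the same limit.
  let U : Ultrafilter ℕ := hyperfilter ℕ
  let G := (U.map p).map fun k => (shiftHomeo toeplitzShift).symm^[k] (proximalPt 0)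
  have hG : Tendsto (fun k => (shiftHomeo toeplitzShift).symm^[k] (proximalPt 0)) (U.map p)
    (𝓝 G.lim) := G.le_nhds_lim
  refine ⟨U.map p, G.lim, fun s => tendsto_subtype_rng.2 (tendsto_pi_nhds.2 fun i => ?_)⟩
  have h0 := tendsto_pi_nhds.1 (tendsto_subtype_rng.1 hG) i
  rw [nhds_discrete, tendsto_pure] at h0 ⊢
  have h1 : ∀ᶠ N in (U : Filter ℕ), i.natAbs ≤ N :=
    Nat.hyperfilter_le_atTop (eventually_ge_atTop i.natAbs)
  change ∀ᶠ N in (U : Filter ℕ), _ at h0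
  change ∀ᶠ N in (U : Filter ℕ), _
  filter_upwards [h0, h1] with N h0 h1
  refine Eq.trans ?_ h0
  simp only [shiftHomeo_symm_iterate]
  exact hp N s 0 i (by omega) (by omega)

/-! ### A Bratteli diagram with two vertices per level

The words `0` and `12` are the units of the subshift. The vertices are the two kinds of units and
the edges are the occurrences of units in the images of units, which consist of `6` and of `10`
units. -/

/-- Whether a letter belongs to a unit `12`. -/
def kind : Fin 3 → Bool := ![false, true, true]

def letterEdge : Fin 3 → Fin 1 ⊕ Fin 2 := ![.inl 0, .inr 0, .inr 1]

/-- The unit containing the letter at position `j` of the image of `s`. -/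
def unitIndex : Fin 3 → Fin 7 → Fin 6 ⊕ Fin 10 :=
  ![![.inl 0, .inl 1, .inl 2, .inl 3, .inl 4, .inl 5, .inl 5],
    ![.inr 0, .inr 1, .inr 2, .inr 3, .inr 3, .inr 4, .inr 4],
    ![.inr 5, .inr 6, .inr 7, .inr 7, .inr 8, .inr 9, .inr 9]]

def unitKind : Fin 6 ⊕ Fin 10 → Bool :=
  Sum.elim ![false, false, false, false, false, true]
    ![false, false, false, true, true, false, false, true, false, true]

instance {a b : ℕ} : DecidableLE (Fin a ⊕ Fin b) :=
  inferInstanceAs (DecidableRel (Sum.LiftRel (· ≤ ·) (· ≤ ·)))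

instance {a b : ℕ} : DecidableLT (Fin a ⊕ Fin b) :=
  inferInstanceAs (DecidableRel (Sum.LiftRel (· < ·) (· < ·)))

/-- In the disjoint-sum order the side of an edge records its range vertex: left for the unit `0`,
right for `12`. -/
theorem Sum.comparable_iff_isRight_eq {a b : ℕ} (e f : Fin a ⊕ Fin b) :
    (e ≤ f ∨ f ≤ e) ↔ e.isRight = f.isRight := by
  rcases e with e | e <;> rcases f with f | f <;> simp [le_total]

theorem isMax_letterEdge_iff : ∀ s, IsMax (letterEdge s) ↔ s ≠ 1 := by
  simp only [IsMax]; decide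

theorem isMin_letterEdge : ∀ s, s ≠ 2 → IsMin (letterEdge s) := by
  simp only [IsMin]; decide

theorem letterEdge_one_covBy : letterEdge 1 ⋖ letterEdge 2 := by
  simp only [CovBy]; decide

theorem letterEdge_bijective : Function.Bijective letterEdge := by
  simp only [Function.Bijective, Function.Injective, Function.Surjective]; decide

theorem isRight_letterEdge : ∀ s, (letterEdge s).isRight = kind s := by decide

theorem unitKind_unitIndex : ∀ s d, unitKind (unitIndex s d) = kind (letter s d) := by decide

theorem isRight_unitIndex : ∀ s d, (unitIndex s d).isRight = kind s := by decide

theorem unitIndex_add_one : ∀ s d, letter s d = 1 →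
    d ≠ 6 ∧ unitIndex s (d + 1) = unitIndex s d := by decide

theorem unitIndex_covBy : ∀ s d, letter s d ≠ 1 → d ≠ 6 →
    unitIndex s d ⋖ unitIndex s (d + 1) := by
  simp only [CovBy]; decide

/-- The image of the unit `12` spans two blocks of length 7; this is the successor relation across
their boundary. -/
theorem unitIndex_one_covBy : unitIndex 1 6 ⋖ unitIndex 2 0 := by
  simp only [CovBy]; decide

theorem isMax_unitIndex : ∀ s, s ≠ 1 → IsMax (unitIndex s 6) := by
  simp only [IsMax]; decide

theorem eq_of_isMax_unitIndex : ∀ s d, letter s d ≠ 1 → IsMax (unitIndex s d) →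
    d = 6 ∧ s ≠ 1 := by
  simp only [IsMax]; decide

theorem isMin_unitIndex : ∀ s, s ≠ 2 → IsMin (unitIndex s 0) := by
  simp only [IsMin]; decide

/-- A unit occurrence alone does not say which half of `12` holds the origin; the letter supplies
that. -/
theorem unitIndex_letter_injective : ∀ s d s' d', unitIndex s d = unitIndex s' d' →
    letter s d = letter s' d' → s = s' ∧ d = d' := by decide

theorem exists_unitIndex_letter : ∀ s e, kind s = unitKind e →
    ∃ s' d, unitIndex s' d = e ∧ letter s' d = s := by decide

theorem exists_edge : ∀ u v : Bool, ∃ e, unitKind e = u ∧ e.isRight = v := by decide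

theorem exists_rootEdge : ∀ v : Bool, ∃ e : Fin 1 ⊕ Fin 2, e.isRight = v := by decide

/-- Both unit images end with `12`, so every maximal edge starts at `true`, which leaves a single
maximal path. Dually, both begin with `0`. -/
theorem eq_of_isMax_edge : ∀ e : Fin 6 ⊕ Fin 10, IsMax e → unitKind e = true ∧
    (e.isRight = true → e = .inr 9) := by
  simp only [IsMax]; decide

theorem eq_of_isMin_edge : ∀ e : Fin 6 ⊕ Fin 10, IsMin e → unitKind e = false ∧
    (e.isRight = false → e = .inl 0) := by
  simp only [IsMin]; decide

theorem eq_of_isMax_rootEdge : ∀ e : Fin 1 ⊕ Fin 2, IsMax e → e.isRight = true → e = .inr 1 := by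
  simp only [IsMax]; decide

theorem eq_of_isMin_rootEdge : ∀ e : Fin 1 ⊕ Fin 2, IsMin e → e.isRight = false → e = .inl 0 := by
  simp only [IsMin]; decide

theorem isMax_lastEdges : IsMax (.inr 1 : Fin 1 ⊕ Fin 2) ∧ IsMax (.inr 9 : Fin 6 ⊕ Fin 10) := by
  simp only [IsMax]; decide

theorem isMin_firstEdges : IsMin (.inl 0 : Fin 1 ⊕ Fin 2) ∧ IsMin (.inl 0 : Fin 6 ⊕ Fin 10) := by
  simp only [IsMin]; decide

/-- The Bratteli diagram of the units. -/
def unitDiagram : OrderedBratteliDiagram where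
  V | 0 => Unit
    | _ + 1 => Bool
  E | 0 => Fin 1 ⊕ Fin 2
    | _ + 1 => Fin 6 ⊕ Fin 10
  fintypeV
    | 0 => inferInstanceAs (Fintype Unit)
    | _ + 1 => inferInstanceAs (Fintype Bool)
  fintypeE
    | 0 => inferInstanceAs (Fintype (Fin 1 ⊕ Fin 2))
    | _ + 1 => inferInstanceAs (Fintype (Fin 6 ⊕ Fin 10))
  root := inferInstanceAs (Unique Unit)
  src {n} := match n with
    | 0 => fun _ => ()
    | _ + 1 => unitKind
  tgt {n} := match n with
    | 0 => Sum.isRight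
    | _ + 1 => Sum.isRight
  src_surjective
    | 0 => fun _ => ⟨.inl 0, rfl⟩
    | _ + 1 => fun u => (exists_edge u true).imp fun _ h => h.1
  tgt_surjective
    | 0 => exists_rootEdge
    | _ + 1 => fun v => (exists_edge true v).imp fun _ h => h.2
  partialOrderE
    | 0 => inferInstanceAs (PartialOrder (Fin 1 ⊕ Fin 2))
    | _ + 1 => inferInstanceAs (PartialOrder (Fin 6 ⊕ Fin 10))
  comparable_iff {n} := match n with
    | 0 => Sum.comparable_iff_isRight_eq
    | _ + 1 => Sum.comparable_iff_isRight_eq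

theorem isSimple_unitDiagram : unitDiagram.IsSimple := by
  have h : ∀ {n : ℕ} (e : unitDiagram.E n),
      unitDiagram.Joined (unitDiagram.src e) (unitDiagram.tgt e) := fun e => .step e .refl
  refine ⟨id, strictMono_id, rfl, fun k u v => ?_⟩
  cases k with
  | zero =>
    obtain ⟨e, he⟩ := exists_rootEdge v
    exact he ▸ h (n := 0) e
  | succ k =>
    obtain ⟨e, he, he'⟩ := exists_edge u v
    exact he ▸ he' ▸ h (n := k + 1) e

theorem rank_unitDiagram : unitDiagram.rank = 2 := by
  have h : (fun n => (Fintype.card (unitDiagram.V n) : ℕ∞)) =ᶠ[atTop] fun _ => 2 := by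
    filter_upwards [eventually_ge_atTop 1] with n hn
    obtain ⟨m, rfl⟩ : ∃ m, n = m + 1 := ⟨n - 1, by omega⟩
    exact congrArg Nat.cast Fintype.card_bool
  rw [BratteliDiagram.rank, liminf_congr h, liminf_const]

theorem isProperlyOrdered_unitDiagram : unitDiagram.IsProperlyOrdered := by
  constructor
  · refine ⟨⟨fun | 0 => (.inr 1 : Fin 1 ⊕ Fin 2) | _ + 1 => (.inr 9 : Fin 6 ⊕ Fin 10), ?_⟩, ?_, ?_⟩
    · rintro (_ | n) <;> rfl
    · rintro (_ | n)
      exacts [isMax_lastEdges.1, isMax_lastEdges.2]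
    · intro e he
      have hk : ∀ n, unitKind (e.1 (n + 1)) = true := fun n => (eq_of_isMax_edge _ (he (n + 1))).1
      apply Subtype.ext
      funext n
      cases n with
      | zero => exact eq_of_isMax_rootEdge _ (he 0) ((e.2 0).trans (hk 0))
      | succ n => exact (eq_of_isMax_edge _ (he (n + 1))).2 ((e.2 (n + 1)).trans (hk (n + 1)))
  · refine ⟨⟨fun | 0 => (.inl 0 : Fin 1 ⊕ Fin 2) | _ + 1 => (.inl 0 : Fin 6 ⊕ Fin 10), ?_⟩, ?_, ?_⟩
    · rintro (_ | n) <;> rfl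
    · rintro (_ | n)
      exacts [isMin_firstEdges.1, isMin_firstEdges.2]
    · intro e he
      have hk : ∀ n, unitKind (e.1 (n + 1)) = false := fun n => (eq_of_isMin_edge _ (he (n + 1))).1
      apply Subtype.ext
      funext n
      cases n with
      | zero => exact eq_of_isMin_rootEdge _ (he 0) ((e.2 0).trans (hk 0))
      | succ n => exact (eq_of_isMin_edge _ (he (n + 1))).2 ((e.2 (n + 1)).trans (hk (n + 1)))

/-! ### Coding points by paths -/

/-- The unit containing the origin, as an occurrence in the image of a unit. -/
def unitAt (y : ℤ → Fin 3) : Fin 6 ⊕ Fin 10 := unitIndex (desubstitute y 0) (digit y)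

theorem iterate_desubstitute_mem {x : ℤ → Fin 3} (hx : x ∈ toeplitzShift.carrier) (n : ℕ) :
    desubstitute^[n] x ∈ toeplitzShift.carrier := by
  induction n with
  | zero => exact hx
  | succ n ih => rw [Function.iterate_succ_apply']; exact desubstitute_mem ih

theorem unitKind_unitAt {y : ℤ → Fin 3} (hy : y ∈ toeplitzShift.carrier) :
    unitKind (unitAt y) = kind (y 0) := by
  rw [unitAt, unitKind_unitIndex, ← apply_zero_eq_letter hy]

/-- The path coding a point. -/
def pathOf (x : toeplitzShift.carrier) : unitDiagram.PathSpace :=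
  ⟨fun
    | 0 => letterEdge (x.1 0)
    | n + 1 => unitAt (desubstitute^[n] x.1), by
    rintro (_ | n)
    · exact (isRight_letterEdge _).trans (unitKind_unitAt x.2).symm
    · change (unitAt (desubstitute^[n] x.1)).isRight = unitKind (unitAt (desubstitute^[n + 1] x.1))
      rw [unitKind_unitAt (iterate_desubstitute_mem x.2 _), Function.iterate_succ_apply']
      exact isRight_unitIndex _ _⟩

theorem continuous_pathOf : Continuous pathOf := by
  refine Continuous.subtype_mk (continuous_pi fun n => ?_) _
  cases n with
  | zero =>
    exact (continuous_of_discreteTopology (β := unitDiagram.E 0) (f := letterEdge)).comp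
      ((continuous_apply (0 : ℤ)).comp continuous_subtype_val)
  | succ n =>
    exact (continuous_of_discreteTopology (β := unitDiagram.E (n + 1))
      (f := fun p : Fin 3 × Fin 7 => unitIndex p.1 p.2)).comp
        ((((continuous_apply (0 : ℤ)).comp continuous_desubstitute).prodMk continuous_digit).comp
          ((continuous_desubstitute.iterate n).comp continuous_subtype_val))

/-- The path and the letter at the origin determine the digit and the central letter at every level.
The constant columns 0 and 6 then let the window grow by one place on each side. -/
theorem eq_on_window (N : ℕ) : ∀ {x x' : ℤ → Fin 3}, x ∈ toeplitzShift.carrier →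
    x' ∈ toeplitzShift.carrier → x 0 = x' 0 →
    (∀ n, unitAt (desubstitute^[n] x) = unitAt (desubstitute^[n] x')) →
    ∀ m : ℤ, -N ≤ m → m ≤ N → x m = x' m := by
  induction N with
  | zero =>
    intro x x' _ _ h _ m h1 h2
    obtain rfl : m = 0 := by omega
    exact h
  | succ N ih =>
    intro x x' hx hx' h0 h m h1 h2
    obtain ⟨e1, e2⟩ := unitIndex_letter_injective _ _ _ _ (h 0)
      (by rw [Function.iterate_zero, id, id, ← apply_zero_eq_letter hx,
        ← apply_zero_eq_letter hx', h0])
    simp only [Function.iterate_zero, id] at e1 e2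
    have ih' := ih (desubstitute_mem hx) (desubstitute_mem hx') e1 fun n => h (n + 1)
    rw [apply_eq_substitute hx, apply_eq_substitute hx', ← e2]
    obtain ⟨q, r, hqr⟩ := exists_eq_mul_add (digit x + m)
    rw [substitute_of_eq _ q r hqr, substitute_of_eq _ q r hqr]
    by_cases hr : r = 0 ∨ r = 6
    · have hc : ∀ (s s' : Fin 3) (r : Fin 7), r = 0 ∨ r = 6 → letter s r = letter s' r := by decide
      exact hc _ _ _ hr
    · rw [ih' q (by omega) (by omega)]

theorem pathOf_injective : Function.Injective pathOf := by
  intro x x' h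
  have h0 : x.1 0 = x'.1 0 := letterEdge_bijective.1 (congrFun (congrArg Subtype.val h) 0)
  have hn : ∀ n, unitAt (desubstitute^[n] x.1) = unitAt (desubstitute^[n] x'.1) :=
    fun n => congrFun (congrArg Subtype.val h) (n + 1)
  apply Subtype.ext
  funext m
  exact eq_on_window m.natAbs x.2 x'.2 h0 hn m (by omega) (by omega)

theorem exists_mem_unitAt_eq (N : ℕ) : ∀ (s : Fin 3) (e : ℕ → Fin 6 ⊕ Fin 10), kind s = unitKind (e 0) →
    (∀ n, (e n).isRight = unitKind (e (n + 1))) →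
    ∃ x ∈ toeplitzShift.carrier, x 0 = s ∧ ∀ n < N, unitAt (desubstitute^[n] x) = e n := by
  induction N with
  | zero =>
    intro s e _ _
    obtain ⟨x, hx, h⟩ := exists_apply_zero_eq s
    exact ⟨x, hx, h, by simp⟩
  | succ N ih =>
    intro s e h0 h
    obtain ⟨s', d, h1, h2⟩ := exists_unitIndex_letter s (e 0) h0
    obtain ⟨y, hy, hys, hye⟩ := ih s' (fun n => e (n + 1))
      (by rw [← h, ← h1, isRight_unitIndex]) fun n => h (n + 1)
    refine ⟨shift (d : ℤ) (substitute y), toeplitzShift.mapsTo _ (substitute_mem hy), ?_, ?_⟩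
    · rw [shift_apply, substitute_of_eq y 0 d (by ring), hys, h2]
    · rintro (_ | n) hn
      · rw [Function.iterate_zero, id, unitAt, desubstitute_shift_substitute,
          digit_shift_substitute, hys, h1]
      · rw [Function.iterate_succ_apply, desubstitute_shift_substitute]
        exact hye n (by omega)

theorem pathOf_surjective : Function.Surjective pathOf := by
  intro e
  obtain ⟨s, hs⟩ := letterEdge_bijective.2 (e.1 0)
  have h0 : kind s = unitKind (e.1 1) := by
    rw [← isRight_letterEdge, hs]
    exact e.2 0
  choose x hx hxs hxe using fun N => exists_mem_unitAt_eq N s (fun n => e.1 (n + 1)) h0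
    fun n => e.2 (n + 1)
  -- Each finite initial segment of the path is realized by a point; a limit of these points
  -- realizes the whole path.
  let U : Ultrafilter ℕ := hyperfilter ℕ
  let G := U.map fun N => (⟨x N, hx N⟩ : toeplitzShift.carrier)
  have hG : Tendsto (fun N => (⟨x N, hx N⟩ : toeplitzShift.carrier)) U (𝓝 G.lim) := G.le_nhds_lim
  have hU : ∀ m : ℕ, ∀ᶠ N in (U : Filter ℕ), m ≤ N := fun m =>
    Nat.hyperfilter_le_atTop (eventually_ge_atTop m)
  refine ⟨G.lim, Subtype.ext (funext fun n => ?_)⟩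
  have hn := ((unitDiagram.continuous_edge n).comp continuous_pathOf).continuousAt.tendsto.comp hG
  rw [nhds_discrete, tendsto_pure] at hn
  obtain ⟨N, h1, h2⟩ := (hn.and (hU (n + 1))).exists
  rw [Function.comp_apply] at h1
  refine Eq.trans h1.symm ?_
  cases n with
  | zero => exact (congrArg letterEdge (hxs N)).trans hs
  | succ n => exact hxe N n (by omega)

/-- Moving from `1` to `2` stays inside one unit, so no edge beyond the root edge changes. -/
theorem unitAt_iterate_shift {y : ℤ → Fin 3} (hy : y ∈ toeplitzShift.carrier) (h : y 0 = 1)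
    (n : ℕ) : unitAt (desubstitute^[n] (shift 1 y)) = unitAt (desubstitute^[n] y) := by
  rw [apply_zero_eq_letter hy] at h
  obtain ⟨h1, h2⟩ := unitIndex_add_one _ _ h
  obtain ⟨h3, h4⟩ := digit_shift_of_ne hy h1
  cases n with
  | zero =>
    rw [Function.iterate_zero, id, id, unitAt, h3, h4, h2]
    rfl
  | succ n => rw [Function.iterate_succ_apply, h4, Function.iterate_succ_apply]

/-- Maximal edges place the origin at the end of its unit at each level, so the shift carries all
the way to level `n` and the new edges are minimal. -/
theorem iterate_shift_of_isMax (x : toeplitzShift.carrier) (n : ℕ)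
    (h : ∀ i ≤ n, IsMax ((pathOf x).1 i)) :
    desubstitute^[n] (shift 1 x.1) = shift 1 (desubstitute^[n] x.1) ∧ desubstitute^[n] x.1 0 ≠ 1 ∧
      ∀ i ≤ n, IsMin ((pathOf (shiftHomeo toeplitzShift x)).1 i) := by
  induction n with
  | zero =>
    have h0 : x.1 0 ≠ 1 := (isMax_letterEdge_iff _).1 (h 0 le_rfl)
    refine ⟨rfl, h0, fun i hi => ?_⟩
    obtain rfl : i = 0 := by omega
    exact isMin_letterEdge _ fun hc => h0 ((apply_eq_one_iff x.2 0).2 hc)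
  | succ n ih =>
    obtain ⟨h1, h2, h3⟩ := ih fun i hi => h i (by omega)
    have hy := iterate_desubstitute_mem x.2 n
    have hmax : IsMax (unitAt (desubstitute^[n] x.1)) := h (n + 1) le_rfl
    obtain ⟨h6, hs⟩ := eq_of_isMax_unitIndex _ _ (by rwa [← apply_zero_eq_letter hy]) hmax
    obtain ⟨h7, h8⟩ := digit_shift_of_eq hy h6
    rw [Function.iterate_succ_apply', Function.iterate_succ_apply', h1]
    refine ⟨h8, hs, fun i hi => ?_⟩
    rcases Nat.le_succ_iff.1 hi with hi | rfl
    · exact h3 i hi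
    · have : IsMin (unitAt (desubstitute^[n] (shift 1 x.1))) := by
        rw [h1, unitAt, h7, h8]
        exact isMin_unitIndex _ fun hc => hs ((apply_eq_one_iff (desubstitute_mem hy) 0).2 hc)
      exact this

theorem vershikStep_pathOf (x : toeplitzShift.carrier) :
    unitDiagram.VershikStep (pathOf x) (pathOf (shiftHomeo toeplitzShift x)) := by
  classical
  by_cases hall : ∀ n, IsMax ((pathOf x).1 n)
  · exact Or.inl ⟨hall, fun n => (iterate_shift_of_isMax x n fun i _ => hall i).2.2 n le_rfl⟩
  · push Not at hall
    have hk := Nat.find_spec hall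
    have hlt : ∀ i < Nat.find hall, IsMax ((pathOf x).1 i) :=
      fun i hi => not_not.1 (Nat.find_min hall hi)
    refine Or.inr ⟨Nat.find hall, hlt, hk, ?_⟩
    generalize Nat.find hall = k at hk hlt
    cases k with
    | zero =>
      have h0 : x.1 0 = 1 := not_not.1 fun hc => hk ((isMax_letterEdge_iff _).2 hc)
      have h1 : x.1 1 = 2 := (apply_eq_one_iff x.2 0).1 h0
      refine ⟨?_, by simp, ?_⟩
      · change letterEdge (x.1 0) ⋖ letterEdge (x.1 1)
        rw [h0, h1]
        exact letterEdge_one_covBy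
      · rintro (_ | i) hi
        · omega
        · exact unitAt_iterate_shift x.2 h0 i
    | succ k =>
      obtain ⟨h1, h2, h3⟩ := iterate_shift_of_isMax x k fun i hi => hlt i (by omega)
      have hy := iterate_desubstitute_mem x.2 k
      have hk' : ¬ IsMax (unitAt (desubstitute^[k] x.1)) := hk
      have hlet := h2
      rw [apply_zero_eq_letter hy] at hlet
      have htail : ∀ i, k + 1 < i → ∃ j, i = (j + (k + 1)) + 1 := fun i hi =>
        ⟨i - (k + 2), by omega⟩
      have hstep : ∀ j, desubstitute^[j + (k + 1)] (shift 1 x.1) =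
          desubstitute^[j] (desubstitute (shift 1 (desubstitute^[k] x.1))) := fun j => by
        rw [Function.iterate_add_apply, Function.iterate_succ_apply' _ k, h1]
      have hstep' : ∀ j, desubstitute^[j + (k + 1)] x.1 =
          desubstitute^[j] (desubstitute (desubstitute^[k] x.1)) := fun j => by
        rw [Function.iterate_add_apply, Function.iterate_succ_apply' _ k]
      -- At the end of a block with a non-maximal edge, the block comes from the first half of a
      -- unit `12`. The shift then enters the block of the second half, in the image of the same
      -- unit, so the higher edges persist.
      by_cases h6 : digit (desubstitute^[k] x.1) = 6
      · obtain ⟨h7, h8⟩ := digit_shift_of_eq hy h6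
        have hs : desubstitute (desubstitute^[k] x.1) 0 = 1 := by
          by_contra hc
          rw [unitAt, h6] at hk'
          exact hk' (isMax_unitIndex _ hc)
        refine ⟨?_, fun i hi => h3 i (by omega), fun i hi => ?_⟩
        · change unitAt (desubstitute^[k] x.1) ⋖ unitAt (desubstitute^[k] (shift 1 x.1))
          have hs' : shift 1 (desubstitute (desubstitute^[k] x.1)) 0 = 2 :=
            (apply_eq_one_iff (desubstitute_mem hy) 0).1 hs
          rw [h1, unitAt, unitAt, h7, h8, h6, hs, hs']
          exact unitIndex_one_covBy
        · obtain ⟨j, rfl⟩ := htail i hi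
          change unitAt (desubstitute^[j + (k + 1)] (shift 1 x.1)) =
            unitAt (desubstitute^[j + (k + 1)] x.1)
          rw [hstep, hstep', h8]
          exact unitAt_iterate_shift (desubstitute_mem hy) hs j
      · obtain ⟨h7, h8⟩ := digit_shift_of_ne hy h6
        refine ⟨?_, fun i hi => h3 i (by omega), fun i hi => ?_⟩
        · change unitAt (desubstitute^[k] x.1) ⋖ unitAt (desubstitute^[k] (shift 1 x.1))
          rw [h1, unitAt, unitAt, h7, h8]
          exact unitIndex_covBy _ _ hlet h6
        · obtain ⟨j, rfl⟩ := htail i hi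
          change unitAt (desubstitute^[j + (k + 1)] (shift 1 x.1)) =
            unitAt (desubstitute^[j + (k + 1)] x.1)
          rw [hstep, hstep', h8]

instance (B : BratteliDiagram) : T2Space B.PathSpace :=
  inferInstanceAs (T2Space {e : ∀ n, B.E n // ∀ n, B.tgt (e n) = B.src (e (n + 1))})

theorem conjugate_unitDiagram : Conjugate (shiftHomeo toeplitzShift)
    (OrderedBratteliDiagram.vershikMap isProperlyOrdered_unitDiagram) :=
  ⟨Continuous.homeoOfEquivCompactToT2
    (f := Equiv.ofBijective pathOf ⟨pathOf_injective, pathOf_surjective⟩) continuous_pathOf,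
    fun x => (OrderedBratteliDiagram.existsUnique_vershikStep isProperlyOrdered_unitDiagram
      (pathOf x)).unique (vershikStep_pathOf x) (OrderedBratteliDiagram.vershikMap_spec _ _)⟩

/-! ### Topological rank exactly two -/

theorem hasTopologicalRank_toeplitzShift : HasTopologicalRank (shiftHomeo toeplitzShift) 2 := by
  refine ⟨isMinimalCantorSystem_toeplitzShift, ⟨unitDiagram, isProperlyOrdered_unitDiagram,
    isSimple_unitDiagram, rank_unitDiagram, conjugate_unitDiagram⟩, ?_⟩
  rintro k ⟨B, hB, -, hrank, hconj⟩
  by_contra! hk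
  -- Two of the three proximal points already contradict rank at most one.
  obtain ⟨F, z, h⟩ := exists_tendsto_proximalPt
  have := OrderedBratteliDiagram.eq_of_rank_le_one hB
    (by rw [hrank]; exact_mod_cast Nat.le_of_lt_succ hk) hconj (h 0) (h 1)
  exact absurd (proximalPt_injective this) (by decide)

end ToeplitzRank

end

theorem mainTheorem1 :
    ∃ (k : ℕ) (X : SymbolicDynamics.FullShift.Subshift (Fin k) ℤ),
      ToeplitzRank.IsToeplitz X ∧
      ToeplitzRank.HasTopologicalRank (ToeplitzRank.shiftHomeo X) 2 ∧
      ¬ ToeplitzRank.IsStrongToeplitz X 2 := by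
  obtain ⟨F, z, h⟩ := ToeplitzRank.exists_tendsto_proximalPt
  exact ⟨3, ToeplitzRank.toeplitzShift,
    ⟨ToeplitzRank.toeplitzPt, ToeplitzRank.isToeplitzSequence_toeplitzPt, rfl⟩,
    ToeplitzRank.hasTopologicalRank_toeplitzShift,
    ToeplitzRank.not_isStrongToeplitz h ToeplitzRank.proximalPt_injective⟩
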